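/- Let $\omega:[0,\infty)\to[0,\infty)$ be a weight function: continuous, nondecreasing, subadditive, $\omega(0)=0$, $\int_1^\infty \omega(t)t^{-2}\,dt<\infty$ and $\omega(t)/\log(1+t)\to\infty$ as $t\to\infty$. Let $\Omega\subseteq\mathbb R^d$ be open. Put $\hat f(\xi)=\int e^{-ix\cdot\xi}f(x)\,dx$ and $\|f\|_{l}=\int|\hat f(\xi)|\,e^{l\omega(|\xi|)}\,d\xi$. Let $\mathcal D^{\{\omega\}}(\Omega)$ be the space of smooth functions $f$ with compact support in $\Omega$ such that $\|f\|_l<\infty$ for some $l>0$. Its dual for the inductive limit topology is $\mathcal D'^{\{\omega\}}(\Omega)$: the linear forms $T$ such that for every compact $K\subset\Omega$ and every $l>0$ there is $C$ with $|\langle T,\varphi\rangle|\le C\|\varphi\|_l$ for all $\varphi\in\mathcal D^{\{\omega\}}(\Omega)$ with support in $K$ and $\|\varphi\|_l<\infty$. Let $\mathcal E^{\{\omega\}}(\Omega)$ be the space of smooth functions $f$ on $\Omega$ such that $\varphi f\in\mathcal D^{\{\omega\}}(\Omega)$ for all $\varphi\in\mathcal D^{\{\omega\}}(\Omega)$, and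 for $K\subset\Omega$ compact let $\|f\|_{K,l}$ be the infimum of $\|\varphi f\|_l$ over all $\varphi\in\mathcal D^{\{\omega\}}(\Omega)$ that are equal to $1$ on $K$. A net $(g_\varepsilon)_{\varepsilon\in(0,1)}$ in $\mathcal E^{\{\omega\}}(\Omega)$ is *moderate* if for every compact $K\subset\Omega$ and every $k>0$ there is $h>0$ with $\|g_\varepsilon\|_{K,h}=o(e^{k\omega(1/\varepsilon)})$ as $\varepsilon\to0$. It is *negligible* if for every compact $K\subset\Omega$ there are $k,h>0$ with $\|g_\varepsilon\|_{K,h}=o(e^{-k\omega(1/\varepsilon)})$. It is *regular* if it is moderate and for every compact $K\subset\Omega$ there is $h>0$ such that $\|g_\varepsilon\|_{K,h}=o(e^{k\omega(1/\varepsilon)})$ for all $k>0$. Let $\mathcal G^{\{\omega\}}(\Omega)$ be the set of moderate nets modulo negligible nets, and let $\mathcal G^{\{\omega\},\infty}(\Omega)$ be the set of classes that have a regular representative. The ring of Roumieu generalized constants is the ring of nets $(z_\varepsilon)$ of complex numbers with $z_\varepsilon=o(e^{m\omega(1/\varepsilon)})$ for all $m>0$, modulo the ideal of those with $z_\varepsilon=o(e^{-m\omega(1/\varepsilon)})$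 for some $m>0$. An ultradistribution $T\in\mathcal D'^{\{\omega\}}(\Omega)$ is *strictly associated* to $g=[(g_\varepsilon)]\in\mathcal G^{\{\omega\}}(\Omega)$ if for every $\rho\in\mathcal D^{\{\omega\}}(\Omega)$ the generalized constant $[(\langle g_\varepsilon-T,\rho\rangle)]$ is zero, where $\langle g_\varepsilon,\rho\rangle=\int g_\varepsilon\rho\,dx$. **Theorem.** If $T\in\mathcal D'^{\{\omega\}}(\Omega)$ is strictly associated to some $g\in\mathcal G^{\{\omega\},\infty}(\Omega)$, then $T\in\mathcal E^{\{\omega\}}(\Omega)$; that is, there is $f\in\mathcal E^{\{\omega\}}(\Omega)$ with $\langle T,\rho\rangle=\int f\rho\,dx$ for all $\rho\in\mathcal D^{\{\omega\}}(\Omega)$. -/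

import Mathlib

open Filter Topology MeasureTheory FourierTransform
open scoped ENNReal

noncomputable section

/-- The class `𝒲` of weight functions on `[0, ∞)`. Only the values at nonnegative arguments are
relevant. -/
structure WeightFunction where
  toFun : ℝ → ℝ
  continuousOn' : ContinuousOn toFun (Set.Ici 0)
  monotoneOn' : MonotoneOn toFun (Set.Ici 0)
  map_zero' : toFun 0 = 0
  subadditive' : ∀ x y : ℝ, 0 ≤ x → 0 ≤ y → toFun (x + y) ≤ toFun x + toFun y
  integrableOn' : IntegrableOn (fun t : ℝ => toFun t / t ^ 2) (Set.Ici 1)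
  tendsto' : Tendsto (fun t : ℝ => toFun t / Real.log (1 + t)) atTop atTop

instance : CoeFun WeightFunction (fun _ => ℝ → ℝ) := ⟨WeightFunction.toFun⟩

namespace WeightFunction

theorem nonneg (ω : WeightFunction) {t : ℝ} (ht : 0 ≤ t) : 0 ≤ ω t := by
  have := ω.monotoneOn' (Set.mem_Ici.2 le_rfl) (Set.mem_Ici.2 ht) ht
  rwa [ω.map_zero'] at this

theorem continuous_norm (ω : WeightFunction) {V : Type*} [NormedAddCommGroup V] :
    Continuous (fun ξ : V => ω ‖ξ‖) :=
  ω.continuousOn'.comp_continuous _root_.continuous_norm (fun ξ => norm_nonneg ξ)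

theorem tendsto_atTop (ω : WeightFunction) : Tendsto (fun t => ω t) atTop atTop := by
  refine tendsto_atTop_mono' atTop ?_ ω.tendsto'
  filter_upwards [eventually_ge_atTop (Real.exp 1)] with t ht
  have h0 : 0 ≤ t := (Real.exp_pos 1).le.trans ht
  have h1 : 1 ≤ Real.log (1 + t) := by
    rw [Real.le_log_iff_exp_le (by linarith)]
    linarith
  exact div_le_self (ω.nonneg h0) h1

end WeightFunction

/-- The Fourier transform `f̂(ξ) = ∫ e^{-i x·ξ} f(x) dx`. -/
def fhat {d : ℕ} (f : EuclideanSpace ℝ (Fin d) → ℂ) (ξ : EuclideanSpace ℝ (Fin d)) : ℂ :=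
  ∫ x, Complex.exp (-(Complex.I * (inner ℝ x ξ : ℝ))) * f x

/-- The norm `∫ |f̂(ξ)| e^{l ω(|ξ|)} dξ`, with values in `[0, ∞]`. -/
def fourierNorm {d : ℕ} (ω : WeightFunction) (l : ℝ) (f : EuclideanSpace ℝ (Fin d) → ℂ) : ℝ≥0∞ :=
  ∫⁻ ξ, ‖fhat f ξ‖ₑ * ENNReal.ofReal (Real.exp (l * ω ‖ξ‖))

theorem fhat_eq {d : ℕ} (f : EuclideanSpace ℝ (Fin d) → ℂ) (ξ : EuclideanSpace ℝ (Fin d)) :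
    fhat f ξ = 𝓕 f ((2 * Real.pi)⁻¹ • ξ) := by
  rw [fhat, Real.fourier_eq']
  refine integral_congr_ae (Eventually.of_forall fun x => ?_)
  have : (2 * Real.pi) ≠ 0 := by positivity
  have h2 : (-2 * Real.pi * inner ℝ x ((2 * Real.pi)⁻¹ • ξ) : ℝ) = - inner ℝ x ξ := by
    rw [inner_smul_right]
    field_simp
  simp only [smul_eq_mul]
  rw [h2]
  congr 2
  push_cast
  ring

theorem continuous_fourier {d : ℕ} {f : EuclideanSpace ℝ (Fin d) → ℂ} (hf : Integrable f) :
    Continuous (𝓕 f) :=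
  VectorFourier.fourierIntegral_continuous Real.continuous_fourierChar
    (continuous_inner (𝕜 := ℝ)) hf

theorem continuous_fhat {d : ℕ} {f : EuclideanSpace ℝ (Fin d) → ℂ} (hf : Integrable f) :
    Continuous (fhat f) := by
  have : fhat f = fun ξ => 𝓕 f ((2 * Real.pi)⁻¹ • ξ) := funext (fhat_eq f)
  rw [this]
  exact (continuous_fourier hf).comp (by fun_prop)

theorem integrable_kernel {d : ℕ} {f : EuclideanSpace ℝ (Fin d) → ℂ} (hf : Integrable f)
    (ξ : EuclideanSpace ℝ (Fin d)) :
    Integrable (fun x => Complex.exp (-(Complex.I * (inner ℝ x ξ : ℝ))) * f x) := by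
  refine hf.bdd_mul (c := 1) (by fun_prop) (Eventually.of_forall fun x => ?_)
  rw [Complex.norm_exp]
  simp

theorem fhat_add {d : ℕ} {f g : EuclideanSpace ℝ (Fin d) → ℂ} (hf : Integrable f)
    (hg : Integrable g) (ξ : EuclideanSpace ℝ (Fin d)) :
    fhat (f + g) ξ = fhat f ξ + fhat g ξ := by
  simp only [fhat, Pi.add_apply, mul_add]
  exact integral_add (integrable_kernel hf ξ) (integrable_kernel hg ξ)

theorem fhat_smul {d : ℕ} (c : ℂ) (f : EuclideanSpace ℝ (Fin d) → ℂ)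
    (ξ : EuclideanSpace ℝ (Fin d)) : fhat (c • f) ξ = c * fhat f ξ := by
  simp only [fhat, Pi.smul_apply, smul_eq_mul]
  rw [← integral_const_mul]
  congr 1
  ext x
  ring

theorem fourierNorm_mono {d : ℕ} (ω : WeightFunction) {l m : ℝ} (h : l ≤ m)
    (f : EuclideanSpace ℝ (Fin d) → ℂ) : fourierNorm ω l f ≤ fourierNorm ω m f := by
  refine lintegral_mono fun ξ => ?_
  gcongr
  exact ω.nonneg (norm_nonneg ξ)

theorem fourierNorm_add_le {d : ℕ} (ω : WeightFunction) (l : ℝ)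
    {f g : EuclideanSpace ℝ (Fin d) → ℂ} (hf : Integrable f) (hg : Integrable g) :
    fourierNorm ω l (f + g) ≤ fourierNorm ω l f + fourierNorm ω l g := by
  have hm : Measurable fun ξ : EuclideanSpace ℝ (Fin d) =>
      ‖fhat f ξ‖ₑ * ENNReal.ofReal (Real.exp (l * ω ‖ξ‖)) := by
    have h1 := (continuous_fhat hf).measurable
    have h2 := (ω.continuous_norm (V := EuclideanSpace ℝ (Fin d))).measurable
    fun_prop
  rw [fourierNorm, fourierNorm, fourierNorm, ← lintegral_add_left hm]
  refine lintegral_mono fun ξ => ?_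
  rw [fhat_add hf hg, ← add_mul]
  gcongr
  exact enorm_add_le _ _

theorem fourierNorm_smul {d : ℕ} (ω : WeightFunction) (l : ℝ) (c : ℂ)
    (f : EuclideanSpace ℝ (Fin d) → ℂ) :
    fourierNorm ω l (c • f) = ‖c‖ₑ * fourierNorm ω l f := by
  simp only [fourierNorm, fhat_smul, enorm_mul, mul_assoc]
  rw [lintegral_const_mul' _ _ enorm_ne_top]

theorem fourierNorm_zero {d : ℕ} (ω : WeightFunction) (l : ℝ) :
    fourierNorm ω l (0 : EuclideanSpace ℝ (Fin d) → ℂ) = 0 := by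
  simp [fourierNorm, fhat]

/-- The space `𝒟^{ω}(Ω)` of Roumieu test functions. -/
def roumieuTestFunctions {d : ℕ} (ω : WeightFunction)
    (Ω : TopologicalSpace.Opens (EuclideanSpace ℝ (Fin d))) :
    Submodule ℂ (EuclideanSpace ℝ (Fin d) → ℂ) where
  carrier := {f | ContDiff ℝ ((⊤ : ℕ∞) : WithTop ℕ∞) f ∧ HasCompactSupport f ∧ tsupport f ⊆ Ω ∧
    ∃ l : ℝ, 0 < l ∧ fourierNorm ω l f < ⊤}
  zero_mem' := by
    refine ⟨contDiff_const, HasCompactSupport.zero, by simp [tsupport], 1, one_pos, ?_⟩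
    rw [fourierNorm_zero]
    exact ENNReal.zero_lt_top
  add_mem' := by
    rintro f g ⟨hf, hfc, hfs, l, hl, hfl⟩ ⟨hg, hgc, hgs, m, hm, hgm⟩
    refine ⟨hf.add hg, hfc.add hgc, (tsupport_add f g).trans (Set.union_subset hfs hgs),
      min l m, lt_min hl hm, ?_⟩
    refine (fourierNorm_add_le ω _ (hf.continuous.integrable_of_hasCompactSupport hfc)
      (hg.continuous.integrable_of_hasCompactSupport hgc)).trans_lt (ENNReal.add_lt_top.2 ⟨?_, ?_⟩)
    · exact (fourierNorm_mono ω (min_le_left l m) f).trans_lt hfl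
    · exact (fourierNorm_mono ω (min_le_right l m) g).trans_lt hgm
  smul_mem' := by
    rintro c f ⟨hf, hfc, hfs, l, hl, hfl⟩
    refine ⟨contDiff_const.smul hf, hfc.smul_left (f := fun _ => c),
      (tsupport_smul_subset_right (fun _ => c) f).trans hfs, l, hl, ?_⟩
    rw [fourierNorm_smul]
    exact ENNReal.mul_lt_top enorm_lt_top hfl

/-- The space `ℰ^{ω}(Ω)`: the smooth functions `f` on `Ω` such that `φ f` is a test function for
every test function `φ`. A function on `Ω` is represented by a function on the whole space, whose
values outside `Ω` play no role. -/
def roumieuFunctions {d : ℕ} (ω : WeightFunction)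
    (Ω : TopologicalSpace.Opens (EuclideanSpace ℝ (Fin d))) :
    Submodule ℂ (EuclideanSpace ℝ (Fin d) → ℂ) where
  carrier := {f | ContDiffOn ℝ ((⊤ : ℕ∞) : WithTop ℕ∞) f Ω ∧
    ∀ φ ∈ roumieuTestFunctions ω Ω, φ * f ∈ roumieuTestFunctions ω Ω}
  zero_mem' := ⟨contDiffOn_const, fun φ _ => by
    rw [mul_zero]
    exact Submodule.zero_mem _⟩
  add_mem' := by
    rintro f g ⟨hf, hf'⟩ ⟨hg, hg'⟩
    refine ⟨hf.add hg, fun φ hφ => ?_⟩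
    rw [mul_add]
    exact Submodule.add_mem _ (hf' φ hφ) (hg' φ hφ)
  smul_mem' := by
    rintro c f ⟨hf, hf'⟩
    refine ⟨contDiffOn_const.smul hf, fun φ hφ => ?_⟩
    rw [mul_smul_comm]
    exact Submodule.smul_mem _ c (hf' φ hφ)

/-- The norm of `f` on the compact set `K`: the infimum of the norms of `φ f`, where `φ` runs
through the test functions that are equal to `1` on `K`. -/
def localNorm {d : ℕ} (ω : WeightFunction)
    (Ω : TopologicalSpace.Opens (EuclideanSpace ℝ (Fin d))) (K : Set (EuclideanSpace ℝ (Fin d)))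
    (l : ℝ) (f : EuclideanSpace ℝ (Fin d) → ℂ) : ℝ≥0∞ :=
  ⨅ φ ∈ {φ : EuclideanSpace ℝ (Fin d) → ℂ | φ ∈ roumieuTestFunctions ω Ω ∧ ∀ x ∈ K, φ x = 1},
    fourierNorm ω l (φ * f)

/-- A Roumieu ultradistribution: a linear form on the test functions which is continuous for the
inductive limit topology, that is, whose restriction to each normed space of test functions with
support in the compact set `K` and with finite norm of index `l` is bounded. -/
structure RoumieuUltradistribution {d : ℕ} (ω : WeightFunction)
    (Ω : TopologicalSpace.Opens (EuclideanSpace ℝ (Fin d))) where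
  toLinearMap : roumieuTestFunctions ω Ω →ₗ[ℂ] ℂ
  bound' : ∀ K : Set (EuclideanSpace ℝ (Fin d)), IsCompact K → K ⊆ Ω → ∀ l : ℝ, 0 < l →
    ∃ C : ℝ, ∀ φ : roumieuTestFunctions ω Ω,
      tsupport (φ : EuclideanSpace ℝ (Fin d) → ℂ) ⊆ K →
      fourierNorm ω l (φ : EuclideanSpace ℝ (Fin d) → ℂ) < ⊤ →
        ‖toLinearMap φ‖ ≤ C * (fourierNorm ω l (φ : EuclideanSpace ℝ (Fin d) → ℂ)).toReal

/-- The pairing `⟨f, φ⟩ = ∫ f(x) φ(x) dx`. -/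
def pairing {d : ℕ} (f φ : EuclideanSpace ℝ (Fin d) → ℂ) : ℂ := ∫ x, f x * φ x

/-- The ultradistribution `T` is (given by integration against) a function of `ℰ^{ω}(Ω)`. -/
def RoumieuUltradistribution.IsUltradifferentiable {d : ℕ} {ω : WeightFunction}
    {Ω : TopologicalSpace.Opens (EuclideanSpace ℝ (Fin d))}
    (T : RoumieuUltradistribution ω Ω) : Prop :=
  ∃ f ∈ roumieuFunctions ω Ω, ∀ φ : roumieuTestFunctions ω Ω, T.toLinearMap φ = pairing f φ

/-- The parameters `ε ∈ (0, 1)` of nets. -/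
abbrev Eps : Type := Set.Ioo (0 : ℝ) 1

/-- The filter `ε → 0` on `(0, 1)`. -/
def epsToZero : Filter Eps := comap (fun ε : Eps => (ε : ℝ)) (𝓝 0)

/-- `N_ε = o(e^{k ω(1/ε)})` as `ε → 0`, for a net with values in `[0, ∞]`. -/
def IsLittleOExp (ω : WeightFunction) (k : ℝ) (N : Eps → ℝ≥0∞) : Prop :=
  Tendsto (fun ε : Eps => N ε * ENNReal.ofReal (Real.exp (-(k * ω (1 / (ε : ℝ)))))) epsToZero (𝓝 0)

theorem Eps.inv_nonneg (ε : Eps) : 0 ≤ 1 / (ε : ℝ) := by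
  have := ε.2.1
  positivity

theorem tendsto_weight_eps (ω : WeightFunction) :
    Tendsto (fun ε : Eps => ω (1 / (ε : ℝ))) epsToZero atTop := by
  refine ω.tendsto_atTop.comp ?_
  have h : Tendsto (fun ε : Eps => (ε : ℝ)) epsToZero (𝓝[>] 0) :=
    tendsto_nhdsWithin_iff.2 ⟨tendsto_comap, Eventually.of_forall fun ε => ε.2.1⟩
  simpa [one_div, Function.comp_def] using tendsto_inv_nhdsGT_zero.comp h

theorem IsLittleOExp.mono {ω : WeightFunction} {k k' : ℝ} {N N' : Eps → ℝ≥0∞}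
    (h : IsLittleOExp ω k N) (hN : ∀ ε, N' ε ≤ N ε) (hk : k ≤ k') : IsLittleOExp ω k' N' := by
  refine tendsto_of_tendsto_of_tendsto_of_le_of_le tendsto_const_nhds h (fun _ => zero_le) ?_
  intro ε
  have := ω.nonneg ε.inv_nonneg
  have := hN ε
  dsimp only
  gcongr

theorem IsLittleOExp.add {ω : WeightFunction} {k : ℝ} {N N' : Eps → ℝ≥0∞}
    (h : IsLittleOExp ω k N) (h' : IsLittleOExp ω k N') :
    IsLittleOExp ω k (fun ε => N ε + N' ε) := by
  have := Tendsto.add h h'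
  simpa [IsLittleOExp, add_mul] using this

theorem IsLittleOExp.mul {ω : WeightFunction} {k k' : ℝ} {N N' : Eps → ℝ≥0∞}
    (h : IsLittleOExp ω k N) (h' : IsLittleOExp ω k' N') :
    IsLittleOExp ω (k + k') (fun ε => N ε * N' ε) := by
  have := ENNReal.Tendsto.mul h (Or.inr ENNReal.zero_ne_top) h' (Or.inr ENNReal.zero_ne_top)
  rw [mul_zero] at this
  refine this.congr fun ε => ?_
  have he : Real.exp (-((k + k') * ω (1 / (ε : ℝ)))) =
      Real.exp (-(k * ω (1 / (ε : ℝ)))) * Real.exp (-(k' * ω (1 / (ε : ℝ)))) := by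
    rw [← Real.exp_add]
    ring_nf
  rw [he, ENNReal.ofReal_mul (Real.exp_pos _).le]
  ring

theorem IsLittleOExp.const_mul {ω : WeightFunction} {k : ℝ} {N : Eps → ℝ≥0∞}
    (h : IsLittleOExp ω k N) {C : ℝ≥0∞} (hC : C ≠ ⊤) : IsLittleOExp ω k (fun ε => C * N ε) := by
  have := ENNReal.Tendsto.const_mul h (Or.inr hC)
  simpa [IsLittleOExp, mul_assoc] using this

theorem isLittleOExp_const {ω : WeightFunction} {k : ℝ} (hk : 0 < k) {C : ℝ≥0∞} (hC : C ≠ ⊤) :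
    IsLittleOExp ω k (fun _ => C) := by
  have h1 : Tendsto (fun ε : Eps => Real.exp (-(k * ω (1 / (ε : ℝ))))) epsToZero (𝓝 0) :=
    Real.tendsto_exp_neg_atTop_nhds_zero.comp ((tendsto_weight_eps ω).const_mul_atTop hk)
  have h2 := ENNReal.Tendsto.const_mul (a := C) (ENNReal.tendsto_ofReal h1) (Or.inr hC)
  simpa [IsLittleOExp] using h2

/-- The ring of Roumieu moderate nets of complex constants: `z_ε = o(e^{m ω(1/ε)})` for all
`m > 0`. -/
def moderateConstants (ω : WeightFunction) : Subring (Eps → ℂ) where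
  carrier := {z | ∀ m : ℝ, 0 < m → IsLittleOExp ω m (fun ε => ‖z ε‖ₑ)}
  mul_mem' := by
    intro a b ha hb m hm
    have := (ha (m / 2) (by positivity)).mul (hb (m / 2) (by positivity))
    simpa using this
  one_mem' := fun m hm => by simpa using isLittleOExp_const (ω := ω) hm ENNReal.one_ne_top
  add_mem' := by
    intro a b ha hb m hm
    exact ((ha m hm).add (hb m hm)).mono (fun ε => enorm_add_le _ _) le_rfl
  zero_mem' := fun m hm => by simpa using isLittleOExp_const (ω := ω) hm ENNReal.zero_ne_top
  neg_mem' := by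
    intro a ha m hm
    simpa using ha m hm

/-- The ideal of Roumieu negligible nets of constants: `z_ε = o(e^{-m ω(1/ε)})` for some
`m > 0`. -/
def negligibleConstants (ω : WeightFunction) : Ideal (moderateConstants ω) where
  carrier := {z | ∃ m : ℝ, 0 < m ∧ IsLittleOExp ω (-m) (fun ε => ‖(z : Eps → ℂ) ε‖ₑ)}
  add_mem' := by
    rintro a b ⟨m, hm, ha⟩ ⟨n, hn, hb⟩
    refine ⟨min m n, lt_min hm hn, ?_⟩
    refine ((ha.mono (fun _ => le_rfl) ?_).add (hb.mono (fun _ => le_rfl) ?_)).mono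
      (fun ε => enorm_add_le _ _) le_rfl
    · exact neg_le_neg (min_le_left _ _)
    · exact neg_le_neg (min_le_right _ _)
  zero_mem' := ⟨1, one_pos, by simpa [IsLittleOExp] using tendsto_const_nhds⟩
  smul_mem' := by
    rintro a b ⟨m, hm, hb⟩
    refine ⟨m / 2, by positivity, ?_⟩
    have := (a.2 (m / 2) (by positivity)).mul hb
    simp only [smul_eq_mul, Subring.coe_mul, Pi.mul_apply, enorm_mul]
    exact this.mono (fun _ => le_rfl) (by linarith)

/-- The ring of Roumieu generalized constants. -/
abbrev GeneralizedConstants (ω : WeightFunction) : Type :=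
  moderateConstants ω ⧸ negligibleConstants ω

/-- The class `[(z_ε)]` in the ring of Roumieu generalized constants exists and is zero. -/
def IsZeroConstant (ω : WeightFunction) (z : Eps → ℂ) : Prop :=
  ∃ hz : z ∈ moderateConstants ω,
    (Ideal.Quotient.mk (negligibleConstants ω) ⟨z, hz⟩ : GeneralizedConstants ω) = 0

theorem isZeroConstant_iff {ω : WeightFunction} {z : Eps → ℂ} :
    IsZeroConstant ω z ↔ ∃ m : ℝ, 0 < m ∧ IsLittleOExp ω (-m) (fun ε => ‖z ε‖ₑ) := by
  constructor
  · rintro ⟨hz, h⟩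
    exact Ideal.Quotient.eq_zero_iff_mem.1 h
  · rintro ⟨m, hm, h⟩
    exact ⟨fun n hn => h.mono (fun _ => le_rfl) (by linarith),
      Ideal.Quotient.eq_zero_iff_mem.2 ⟨m, hm, h⟩⟩

/-- The Roumieu moderate nets of elements of `ℰ^{ω}(Ω)`. -/
def IsModerateNet {d : ℕ} (ω : WeightFunction)
    (Ω : TopologicalSpace.Opens (EuclideanSpace ℝ (Fin d)))
    (g : Eps → roumieuFunctions ω Ω) : Prop :=
  ∀ K : Set (EuclideanSpace ℝ (Fin d)), IsCompact K → K ⊆ Ω → ∀ k : ℝ, 0 < k →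
    ∃ h : ℝ, 0 < h ∧ IsLittleOExp ω k (fun ε => localNorm ω Ω K h (g ε))

/-- The Roumieu negligible nets of elements of `ℰ^{ω}(Ω)`. -/
def IsNegligibleNet {d : ℕ} (ω : WeightFunction)
    (Ω : TopologicalSpace.Opens (EuclideanSpace ℝ (Fin d)))
    (g : Eps → roumieuFunctions ω Ω) : Prop :=
  ∀ K : Set (EuclideanSpace ℝ (Fin d)), IsCompact K → K ⊆ Ω →
    ∃ k : ℝ, 0 < k ∧ ∃ h : ℝ, 0 < h ∧ IsLittleOExp ω (-k) (fun ε => localNorm ω Ω K h (g ε))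

/-- The Roumieu regular nets of elements of `ℰ^{ω}(Ω)`. -/
def IsRegularNet {d : ℕ} (ω : WeightFunction)
    (Ω : TopologicalSpace.Opens (EuclideanSpace ℝ (Fin d)))
    (g : Eps → roumieuFunctions ω Ω) : Prop :=
  IsModerateNet ω Ω g ∧
  ∀ K : Set (EuclideanSpace ℝ (Fin d)), IsCompact K → K ⊆ Ω →
    ∃ h : ℝ, 0 < h ∧ ∀ k : ℝ, 0 < k → IsLittleOExp ω k (fun ε => localNorm ω Ω K h (g ε))

/-! Estimates for products, used to see that equality modulo negligible nets is an equivalence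
relation on moderate nets, which is compatible with the pairing with test functions. -/

theorem fourier_mul_eq {d : ℕ} {f g : EuclideanSpace ℝ (Fin d) → ℂ}
    (hf : ContDiff ℝ ((⊤ : ℕ∞) : WithTop ℕ∞) f) (hfc : HasCompactSupport f)
    (hg : ContDiff ℝ ((⊤ : ℕ∞) : WithTop ℕ∞) g) (hgc : HasCompactSupport g)
    (ξ : EuclideanSpace ℝ (Fin d)) :
    𝓕 (f * g) ξ = ∫ η, 𝓕 f (-η) * 𝓕 g (ξ + η) := by
  have h := SchwartzMap.convolution_apply (ContinuousLinearMap.mul ℂ ℂ)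
    (𝓕⁻ (hfc.toSchwartzMap hf)) (𝓕⁻ (hgc.toSchwartzMap hg)) (-ξ)
  have h2 : SchwartzMap.convolution (ContinuousLinearMap.mul ℂ ℂ)
    (𝓕⁻ (hfc.toSchwartzMap hf)) (𝓕⁻ (hgc.toSchwartzMap hg)) =
      𝓕⁻ (SchwartzMap.pairing (ContinuousLinearMap.mul ℂ ℂ) (hfc.toSchwartzMap hf)
        (hgc.toSchwartzMap hg)) := by
    simp [SchwartzMap.convolution]
  rw [h2, SchwartzMap.fourierInv_coe, SchwartzMap.fourierInv_coe, SchwartzMap.fourierInv_coe,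
    Real.fourierInv_eq_fourier_neg, neg_neg] at h
  have h3 : ((SchwartzMap.pairing (ContinuousLinearMap.mul ℂ ℂ) (hfc.toSchwartzMap hf)
        (hgc.toSchwartzMap hg) : SchwartzMap _ _) : EuclideanSpace ℝ (Fin d) → ℂ) = f * g := by
    ext x
    simp
  rw [h3] at h
  rw [h, MeasureTheory.convolution]
  refine integral_congr_ae (Eventually.of_forall fun η => ?_)
  simp only [Real.fourierInv_eq_fourier_neg, ContinuousLinearMap.mul_apply']
  have : -(-ξ - η) = ξ + η := by abel
  rw [this]
  rfl

theorem lintegral_comp_smul {d : ℕ} (F : EuclideanSpace ℝ (Fin d) → ℝ≥0∞) {r : ℝ} (hr : r ≠ 0) :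
    ∫⁻ x, F (r • x) = ENNReal.ofReal |(r ^ d)⁻¹| * ∫⁻ x, F x := by
  have h := lintegral_map_equiv (μ := (volume : Measure (EuclideanSpace ℝ (Fin d)))) F
    (Homeomorph.smulOfNeZero r hr).toMeasurableEquiv
  have h2 : Measure.map ((Homeomorph.smulOfNeZero r hr).toMeasurableEquiv)
      (volume : Measure (EuclideanSpace ℝ (Fin d))) = ENNReal.ofReal |(r ^ d)⁻¹| • volume := by
    have := Measure.map_addHaar_smul (volume : Measure (EuclideanSpace ℝ (Fin d))) hr
    simpa using this
  rw [h2, lintegral_smul_measure] at h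
  exact h.symm

/-- A constant relating the two normalizations of the Fourier transform. -/
def fourierConst (d : ℕ) : ℝ≥0∞ := ENNReal.ofReal |(((2 * Real.pi)⁻¹ : ℝ) ^ d)⁻¹|

theorem fourierConst_ne_top (d : ℕ) : fourierConst d ≠ ⊤ := ENNReal.ofReal_ne_top

theorem one_le_fourierConst (d : ℕ) : 1 ≤ fourierConst d := by
  rw [fourierConst, ENNReal.one_le_ofReal, ← inv_pow, inv_inv]
  refine le_trans ?_ (le_abs_self _)
  exact one_le_pow₀ (by linarith [Real.pi_gt_three])

theorem fourierNorm_eq {d : ℕ} (ω : WeightFunction) (l : ℝ)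
    (f : EuclideanSpace ℝ (Fin d) → ℂ) :
    fourierNorm ω l f = fourierConst d *
      ∫⁻ ξ, ‖𝓕 f ξ‖ₑ * ENNReal.ofReal (Real.exp (l * ω ‖(2 * Real.pi) • ξ‖)) := by
  have h2 : (2 * Real.pi) ≠ 0 := by positivity
  rw [fourierConst, ← lintegral_comp_smul _ (inv_ne_zero h2), fourierNorm]
  simp only [fhat_eq, smul_inv_smul₀ h2]

theorem fourierNorm_mul_le {d : ℕ} (ω : WeightFunction) {l : ℝ} (hl : 0 ≤ l)
    {f g : EuclideanSpace ℝ (Fin d) → ℂ}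
    (hf : ContDiff ℝ ((⊤ : ℕ∞) : WithTop ℕ∞) f) (hfc : HasCompactSupport f)
    (hg : ContDiff ℝ ((⊤ : ℕ∞) : WithTop ℕ∞) g) (hgc : HasCompactSupport g) :
    fourierNorm ω l (f * g) ≤ fourierNorm ω l f * fourierNorm ω l g := by
  set W : EuclideanSpace ℝ (Fin d) → ℝ≥0∞ := fun ξ =>
    ENNReal.ofReal (Real.exp (l * ω ‖(2 * Real.pi) • ξ‖)) with hW
  have hWm : Measurable W := by
    have h2 : Continuous fun ξ : EuclideanSpace ℝ (Fin d) => ω ‖(2 * Real.pi) • ξ‖ :=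
      ω.continuous_norm.comp (continuous_const_smul (2 * Real.pi))
    have := h2.measurable
    fun_prop
  have hWneg : ∀ η, W (-η) = W η := fun η => by
    simp only [hW, smul_neg, _root_.norm_neg]
  have hWsub : ∀ ξ η, W ξ ≤ W η * W (ξ + η) := by
    intro ξ η
    rw [hW]
    dsimp only
    rw [← ENNReal.ofReal_mul (Real.exp_pos _).le, ← Real.exp_add, ← mul_add]
    gcongr
    refine le_trans ?_ (ω.subadditive' _ _ (norm_nonneg _) (norm_nonneg _))
    refine ω.monotoneOn' (norm_nonneg _) (Set.mem_Ici.2 (by positivity)) ?_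
    have : (2 * Real.pi) • ξ = (2 * Real.pi) • (ξ + η) - (2 * Real.pi) • η := by
      rw [← smul_sub, add_sub_cancel_right]
    rw [this]
    exact (norm_sub_le ((2 * Real.pi) • (ξ + η)) ((2 * Real.pi) • η)).trans_eq (add_comm _ _)
  have hfm : Measurable (𝓕 f) :=
    (continuous_fourier (hf.continuous.integrable_of_hasCompactSupport hfc)).measurable
  have hgm : Measurable (𝓕 g) :=
    (continuous_fourier (hg.continuous.integrable_of_hasCompactSupport hgc)).measurable
  have key : ∫⁻ ξ, ‖𝓕 (f * g) ξ‖ₑ * W ξ ≤ (∫⁻ ξ, ‖𝓕 f ξ‖ₑ * W ξ) * ∫⁻ ξ, ‖𝓕 g ξ‖ₑ * W ξ := by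
    calc ∫⁻ ξ, ‖𝓕 (f * g) ξ‖ₑ * W ξ
        ≤ ∫⁻ ξ, ∫⁻ η, (‖𝓕 f (-η)‖ₑ * W η) * (‖𝓕 g (ξ + η)‖ₑ * W (ξ + η)) := by
          refine lintegral_mono fun ξ => ?_
          dsimp only
          rw [fourier_mul_eq hf hfc hg hgc]
          calc _ ≤ (∫⁻ η, ‖𝓕 f (-η) * 𝓕 g (ξ + η)‖ₑ) * W ξ := by
                gcongr
                exact enorm_integral_le_lintegral_enorm _
            _ = ∫⁻ η, ‖𝓕 f (-η) * 𝓕 g (ξ + η)‖ₑ * W ξ :=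
                (lintegral_mul_const' _ _ ENNReal.ofReal_ne_top).symm
            _ ≤ _ := by
                refine lintegral_mono fun η => ?_
                dsimp only
                rw [enorm_mul]
                calc _ ≤ ‖𝓕 f (-η)‖ₑ * ‖𝓕 g (ξ + η)‖ₑ * (W η * W (ξ + η)) := by
                      gcongr
                      exact hWsub ξ η
                  _ = _ := by ring
      _ = ∫⁻ η, ∫⁻ ξ, (‖𝓕 f (-η)‖ₑ * W η) * (‖𝓕 g (ξ + η)‖ₑ * W (ξ + η)) := by
          refine lintegral_lintegral_swap (Measurable.aemeasurable ?_)
          simp only [Function.uncurry_def]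
          fun_prop
      _ = ∫⁻ η, (‖𝓕 f (-η)‖ₑ * W (-η)) * ∫⁻ ξ, ‖𝓕 g ξ‖ₑ * W ξ := by
          refine lintegral_congr fun η => ?_
          rw [lintegral_const_mul _ (by fun_prop),
            lintegral_add_right_eq_self (fun ξ => ‖𝓕 g ξ‖ₑ * W ξ) η, hWneg]
      _ = _ := by
          rw [lintegral_mul_const _ (by fun_prop),
            lintegral_neg_eq_self (fun η => ‖𝓕 f η‖ₑ * W η)]
  rw [fourierNorm_eq, fourierNorm_eq ω l f, fourierNorm_eq ω l g]
  calc _ ≤ fourierConst d * ((∫⁻ ξ, ‖𝓕 f ξ‖ₑ * W ξ) * ∫⁻ ξ, ‖𝓕 g ξ‖ₑ * W ξ) := by gcongr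
    _ ≤ fourierConst d * ((∫⁻ ξ, ‖𝓕 f ξ‖ₑ * W ξ) * ∫⁻ ξ, ‖𝓕 g ξ‖ₑ * W ξ) * fourierConst d :=
        le_mul_of_one_le_right zero_le (one_le_fourierConst d)
    _ = _ := by ring

theorem enorm_le_fourierNorm {d : ℕ} (ω : WeightFunction) {l : ℝ} (hl : 0 ≤ l)
    {f : EuclideanSpace ℝ (Fin d) → ℂ}
    (hf : ContDiff ℝ ((⊤ : ℕ∞) : WithTop ℕ∞) f) (hfc : HasCompactSupport f)
    (x : EuclideanSpace ℝ (Fin d)) : ‖f x‖ₑ ≤ fourierNorm ω l f := by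
  have hi : Integrable (𝓕 f) := by
    have := (𝓕 (hfc.toSchwartzMap hf)).integrable (μ := volume)
    rwa [SchwartzMap.fourier_coe] at this
  have h := congrFun (hf.continuous.fourierInv_fourier_eq
    (hf.continuous.integrable_of_hasCompactSupport hfc) hi) x
  rw [← h, Real.fourierInv_eq', fourierNorm_eq]
  refine (enorm_integral_le_lintegral_enorm _).trans ?_
  refine le_trans (lintegral_mono fun ξ => ?_)
    (le_mul_of_one_le_left zero_le (one_le_fourierConst d))
  dsimp only
  rw [enorm_smul]
  have h1 : ‖Complex.exp (((2 * Real.pi * inner ℝ ξ x : ℝ) : ℂ) * Complex.I)‖ₑ = 1 := by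
    rw [← ofReal_norm, Complex.norm_exp_ofReal_mul_I, ENNReal.ofReal_one]
  rw [h1, one_mul]
  refine le_mul_of_one_le_right zero_le ?_
  rw [ENNReal.one_le_ofReal]
  exact Real.one_le_exp (mul_nonneg hl (ω.nonneg (norm_nonneg _)))

theorem localNorm_mono {d : ℕ} (ω : WeightFunction)
    (Ω : TopologicalSpace.Opens (EuclideanSpace ℝ (Fin d))) (K : Set (EuclideanSpace ℝ (Fin d)))
    {l m : ℝ} (h : l ≤ m) (f : EuclideanSpace ℝ (Fin d) → ℂ) :
    localNorm ω Ω K l f ≤ localNorm ω Ω K m f :=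
  iInf₂_mono fun φ _ => fourierNorm_mono ω h (φ * f)

theorem localNorm_neg {d : ℕ} (ω : WeightFunction)
    (Ω : TopologicalSpace.Opens (EuclideanSpace ℝ (Fin d))) (K : Set (EuclideanSpace ℝ (Fin d)))
    (l : ℝ) (f : EuclideanSpace ℝ (Fin d) → ℂ) :
    localNorm ω Ω K l (-f) = localNorm ω Ω K l f := by
  refine iInf_congr fun φ => iInf_congr fun _ => ?_
  have : φ * -f = (-1 : ℂ) • (φ * f) := by
    ext x
    simp
  rw [this, fourierNorm_smul]
  simp

theorem localNorm_zero {d : ℕ} {ω : WeightFunction}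
    {Ω : TopologicalSpace.Opens (EuclideanSpace ℝ (Fin d))} {K : Set (EuclideanSpace ℝ (Fin d))}
    {φ : EuclideanSpace ℝ (Fin d) → ℂ} (hφ : φ ∈ roumieuTestFunctions ω Ω)
    (h1 : ∀ x ∈ K, φ x = 1) (l : ℝ) : localNorm ω Ω K l 0 = 0 := by
  refine le_antisymm ((iInf₂_le φ ⟨hφ, h1⟩).trans ?_) zero_le
  rw [mul_zero, fourierNorm_zero]

theorem mul_eq_mul_of_eq_one {d : ℕ} {K : Set (EuclideanSpace ℝ (Fin d))}
    {φ ψ f : EuclideanSpace ℝ (Fin d) → ℂ} (hK : tsupport φ ⊆ K) (h1 : ∀ x ∈ K, ψ x = 1) :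
    φ * (ψ * f) = φ * f := by
  ext x
  by_cases hx : x ∈ tsupport φ
  · simp [h1 x (hK hx)]
  · simp [image_eq_zero_of_notMem_tsupport hx]

theorem fourierNorm_mul_le_localNorm {d : ℕ} {ω : WeightFunction}
    {Ω : TopologicalSpace.Opens (EuclideanSpace ℝ (Fin d))} {K : Set (EuclideanSpace ℝ (Fin d))}
    {φ f : EuclideanSpace ℝ (Fin d) → ℂ} {l : ℝ} (hl : 0 ≤ l)
    (hφ : φ ∈ roumieuTestFunctions ω Ω) (hK : tsupport φ ⊆ K) (hφl : fourierNorm ω l φ ≠ ⊤)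
    (hf : f ∈ roumieuFunctions ω Ω) :
    fourierNorm ω l (φ * f) ≤ (fourierNorm ω l φ + 1) * localNorm ω Ω K l f := by
  have h0 : fourierNorm ω l φ + 1 ≠ 0 := by simp
  have ht : fourierNorm ω l φ + 1 ≠ ⊤ := by simp [hφl]
  rw [← ENNReal.div_le_iff' h0 ht]
  refine le_iInf₂ fun ψ hψ => ?_
  rw [ENNReal.div_le_iff' h0 ht, ← mul_eq_mul_of_eq_one hK hψ.2]
  have hψf := hf.2 ψ hψ.1
  refine (fourierNorm_mul_le ω hl hφ.1 hφ.2.1 hψf.1 hψf.2.1).trans ?_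
  gcongr
  exact le_self_add

theorem exists_cutoff {d : ℕ} {ω : WeightFunction}
    {Ω : TopologicalSpace.Opens (EuclideanSpace ℝ (Fin d))} {K : Set (EuclideanSpace ℝ (Fin d))}
    {l k : ℝ} {g : Eps → roumieuFunctions ω Ω}
    (hg : IsLittleOExp ω k (fun ε => localNorm ω Ω K l (g ε))) :
    ∃ φ ∈ roumieuTestFunctions ω Ω, ∀ x ∈ K, φ x = 1 := by
  by_contra hcon
  have htop : ∀ f : EuclideanSpace ℝ (Fin d) → ℂ, localNorm ω Ω K l f = ⊤ := by
    intro f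
    rw [localNorm]
    simp only [iInf_eq_top]
    intro φ hφ
    exact absurd ⟨φ, hφ.1, hφ.2⟩ hcon
  have hne : epsToZero.NeBot := by
    rw [epsToZero, comap_neBot_iff]
    intro t ht
    obtain ⟨δ, hδ, hδt⟩ := Metric.mem_nhds_iff.1 ht
    refine ⟨⟨min (δ / 2) (1 / 2), by positivity, ?_⟩, hδt ?_⟩
    · exact (min_le_right _ _).trans_lt (by norm_num)
    · have h1 : 0 < min (δ / 2) (1 / 2) := by positivity
      rw [Metric.mem_ball, Real.dist_eq, sub_zero, abs_of_pos h1]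
      exact (min_le_left _ _).trans_lt (by linarith)
  have : (fun ε : Eps => localNorm ω Ω K l (g ε) *
      ENNReal.ofReal (Real.exp (-(k * ω (1 / (ε : ℝ)))))) = fun _ => ⊤ := by
    ext ε
    rw [htop, ENNReal.top_mul]
    simp [Real.exp_pos]
  rw [IsLittleOExp, this] at hg
  exact ENNReal.top_ne_zero (tendsto_nhds_unique tendsto_const_nhds hg)

theorem IsNegligibleNet.add {d : ℕ} {ω : WeightFunction}
    {Ω : TopologicalSpace.Opens (EuclideanSpace ℝ (Fin d))} {f g : Eps → roumieuFunctions ω Ω}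
    (hf : IsNegligibleNet ω Ω f) (hg : IsNegligibleNet ω Ω g) : IsNegligibleNet ω Ω (f + g) := by
  intro K hK hKΩ
  obtain ⟨_, _, _, _, hf0⟩ := hf K hK hKΩ
  obtain ⟨φ, hφ, hφ1⟩ := exists_cutoff hf0
  obtain ⟨hφs, hφc, hφΩ, h₀, hh₀, hφh⟩ := id hφ
  obtain ⟨k₁, hk₁, h₁, hh₁, hf1⟩ := hf _ hφc hφΩ
  obtain ⟨k₂, hk₂, h₂, hh₂, hg1⟩ := hg _ hφc hφΩ
  set h := min h₀ (min h₁ h₂) with hh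
  have hpos : 0 < h := lt_min hh₀ (lt_min hh₁ hh₂)
  have hfin : fourierNorm ω h φ ≠ ⊤ :=
    ((fourierNorm_mono ω (min_le_left _ _) φ).trans_lt hφh).ne
  refine ⟨min k₁ k₂, lt_min hk₁ hk₂, h, hpos, ?_⟩
  have e1 : IsLittleOExp ω (-(min k₁ k₂))
      (fun ε => localNorm ω Ω (tsupport φ) h (f ε : EuclideanSpace ℝ (Fin d) → ℂ)) :=
    hf1.mono (fun ε => localNorm_mono ω Ω _ ((min_le_right _ _).trans (min_le_left _ _)) _)
      (neg_le_neg (min_le_left _ _))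
  have e2 : IsLittleOExp ω (-(min k₁ k₂))
      (fun ε => localNorm ω Ω (tsupport φ) h (g ε : EuclideanSpace ℝ (Fin d) → ℂ)) :=
    hg1.mono (fun ε => localNorm_mono ω Ω _ ((min_le_right _ _).trans (min_le_right _ _)) _)
      (neg_le_neg (min_le_right _ _))
  refine ((e1.add e2).const_mul (C := fourierNorm ω h φ + 1) (by simp [hfin])).mono
    (fun ε => ?_) le_rfl
  refine (iInf₂_le φ ⟨hφ, hφ1⟩).trans ?_
  have hf2 := (f ε).2.2 φ hφ
  have hg2 := (g ε).2.2 φ hφ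
  rw [Pi.add_apply, Submodule.coe_add, mul_add, mul_add]
  refine (fourierNorm_add_le ω h (hf2.1.continuous.integrable_of_hasCompactSupport hf2.2.1)
    (hg2.1.continuous.integrable_of_hasCompactSupport hg2.2.1)).trans ?_
  exact add_le_add
    (fourierNorm_mul_le_localNorm hpos.le hφ subset_rfl hfin (f ε).2)
    (fourierNorm_mul_le_localNorm hpos.le hφ subset_rfl hfin (g ε).2)

theorem IsNegligibleNet.neg {d : ℕ} {ω : WeightFunction}
    {Ω : TopologicalSpace.Opens (EuclideanSpace ℝ (Fin d))} {f : Eps → roumieuFunctions ω Ω}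
    (hf : IsNegligibleNet ω Ω f) : IsNegligibleNet ω Ω (-f) := by
  intro K hK hKΩ
  obtain ⟨k, hk, h, hh, hf⟩ := hf K hK hKΩ
  exact ⟨k, hk, h, hh, hf.mono (fun ε => (localNorm_neg ω Ω K h _).le) le_rfl⟩

theorem IsModerateNet.isNegligibleNet_zero {d : ℕ} {ω : WeightFunction}
    {Ω : TopologicalSpace.Opens (EuclideanSpace ℝ (Fin d))} {f : Eps → roumieuFunctions ω Ω}
    (hf : IsModerateNet ω Ω f) : IsNegligibleNet ω Ω (0 : Eps → roumieuFunctions ω Ω) := by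
  intro K hK hKΩ
  obtain ⟨h, hh, hf⟩ := hf K hK hKΩ 1 one_pos
  obtain ⟨φ, hφ, hφ1⟩ := exists_cutoff hf
  refine ⟨1, one_pos, 1, one_pos, ?_⟩
  have : (fun ε => localNorm ω Ω K 1
      ((0 : Eps → roumieuFunctions ω Ω) ε : EuclideanSpace ℝ (Fin d) → ℂ)) = fun _ => 0 := by
    ext ε
    exact localNorm_zero hφ hφ1 1
  rw [this]
  simpa [IsLittleOExp] using tendsto_const_nhds

/-- Equality of moderate nets modulo negligible nets. -/
def moderateNetSetoid {d : ℕ} (ω : WeightFunction)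
    (Ω : TopologicalSpace.Opens (EuclideanSpace ℝ (Fin d))) :
    Setoid {g : Eps → roumieuFunctions ω Ω // IsModerateNet ω Ω g} where
  r f g := IsNegligibleNet ω Ω (f.1 - g.1)
  iseqv :=
    { refl := fun f => by
        rw [sub_self]
        exact f.2.isNegligibleNet_zero
      symm := fun {f g} h => by
        rw [← neg_sub]
        exact h.neg
      trans := fun {f g k} h h' => by
        rw [← sub_add_sub_cancel f.1 g.1 k.1]
        exact h.add h' }

/-- The space `𝒢^{ω}(Ω)` of Roumieu generalized ultradifferentiable functions: moderate nets
modulo negligible nets. -/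
def RoumieuGeneralizedFunction {d : ℕ} (ω : WeightFunction)
    (Ω : TopologicalSpace.Opens (EuclideanSpace ℝ (Fin d))) : Type :=
  Quotient (moderateNetSetoid ω Ω)

/-- The elements of `𝒢^{ω,∞}(Ω)`: classes that have a regular representative. -/
def RoumieuGeneralizedFunction.IsRegular {d : ℕ} {ω : WeightFunction}
    {Ω : TopologicalSpace.Opens (EuclideanSpace ℝ (Fin d))}
    (g : RoumieuGeneralizedFunction ω Ω) : Prop :=
  ∃ f : {f : Eps → roumieuFunctions ω Ω // IsModerateNet ω Ω f},
    Quotient.mk (moderateNetSetoid ω Ω) f = g ∧ IsRegularNet ω Ω f.1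

theorem integrable_pairing {d : ℕ} {ω : WeightFunction}
    {Ω : TopologicalSpace.Opens (EuclideanSpace ℝ (Fin d))}
    (f : roumieuFunctions ω Ω) (ρ : roumieuTestFunctions ω Ω) :
    Integrable (fun x => (f : EuclideanSpace ℝ (Fin d) → ℂ) x *
      (ρ : EuclideanSpace ℝ (Fin d) → ℂ) x) := by
  have h := f.2.2 ρ ρ.2
  have := h.1.continuous.integrable_of_hasCompactSupport (μ := volume) h.2.1
  refine this.congr (Eventually.of_forall fun x => ?_)
  simp [mul_comm]

theorem enorm_pairing_le {d : ℕ} {ω : WeightFunction}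
    {Ω : TopologicalSpace.Opens (EuclideanSpace ℝ (Fin d))}
    (f : roumieuFunctions ω Ω) (ρ : roumieuTestFunctions ω Ω) {h : ℝ} (hh : 0 ≤ h) :
    ‖pairing (f : EuclideanSpace ℝ (Fin d) → ℂ) ρ‖ₑ ≤
      ((∫⁻ x, ‖(ρ : EuclideanSpace ℝ (Fin d) → ℂ) x‖ₑ) + 1) *
        localNorm ω Ω (tsupport (ρ : EuclideanSpace ℝ (Fin d) → ℂ)) h f := by
  have hρi : ∫⁻ x, ‖(ρ : EuclideanSpace ℝ (Fin d) → ℂ) x‖ₑ ≠ ⊤ :=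
    (ρ.2.1.continuous.integrable_of_hasCompactSupport ρ.2.2.1).hasFiniteIntegral.ne
  set A := ∫⁻ x, ‖(ρ : EuclideanSpace ℝ (Fin d) → ℂ) x‖ₑ with hA
  have h0 : A + 1 ≠ 0 := by simp
  have ht : A + 1 ≠ ⊤ := by simp [hρi]
  rw [← ENNReal.div_le_iff' h0 ht]
  refine le_iInf₂ fun ψ hψ => ?_
  rw [ENNReal.div_le_iff' h0 ht]
  have hψf := f.2.2 ψ hψ.1
  have heq : pairing (f : EuclideanSpace ℝ (Fin d) → ℂ) ρ =
      ∫ x, (ρ : EuclideanSpace ℝ (Fin d) → ℂ) x * (ψ * (f : EuclideanSpace ℝ (Fin d) → ℂ)) x := by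
    refine integral_congr_ae (Eventually.of_forall fun x => ?_)
    have := congrFun (mul_eq_mul_of_eq_one
      (f := (f : EuclideanSpace ℝ (Fin d) → ℂ)) subset_rfl hψ.2) x
    simp only [Pi.mul_apply] at this ⊢
    rw [this, mul_comm]
  rw [heq]
  refine (enorm_integral_le_lintegral_enorm _).trans ?_
  calc _ ≤ ∫⁻ x, ‖(ρ : EuclideanSpace ℝ (Fin d) → ℂ) x‖ₑ * fourierNorm ω h (ψ * (f : EuclideanSpace ℝ (Fin d) → ℂ)) := by
        refine lintegral_mono fun x => ?_
        dsimp only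
        rw [enorm_mul]
        gcongr
        exact enorm_le_fourierNorm ω hh hψf.1 hψf.2.1 x
    _ = A * fourierNorm ω h (ψ * (f : EuclideanSpace ℝ (Fin d) → ℂ)) := by
        rw [hA, lintegral_mul_const _ ρ.2.1.continuous.measurable.enorm]
    _ ≤ _ := by
        gcongr
        exact le_self_add

theorem isZeroConstant_pairing {d : ℕ} {ω : WeightFunction}
    {Ω : TopologicalSpace.Opens (EuclideanSpace ℝ (Fin d))} {g : Eps → roumieuFunctions ω Ω}
    (hg : IsNegligibleNet ω Ω g) (ρ : roumieuTestFunctions ω Ω) :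
    IsZeroConstant ω (fun ε => pairing (g ε : EuclideanSpace ℝ (Fin d) → ℂ) ρ) := by
  obtain ⟨k, hk, h, hh, hg⟩ := hg _ ρ.2.2.1 ρ.2.2.2.1
  refine isZeroConstant_iff.2 ⟨k, hk, (hg.const_mul
    (C := (∫⁻ x, ‖(ρ : EuclideanSpace ℝ (Fin d) → ℂ) x‖ₑ) + 1) ?_).mono
    (fun ε => enorm_pairing_le (g ε) ρ hh.le) le_rfl⟩
  have : ∫⁻ x, ‖(ρ : EuclideanSpace ℝ (Fin d) → ℂ) x‖ₑ ≠ ⊤ :=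
    (ρ.2.1.continuous.integrable_of_hasCompactSupport ρ.2.2.1).hasFiniteIntegral.ne
  simp [this]

theorem IsZeroConstant.add {ω : WeightFunction} {y z : Eps → ℂ} (hy : IsZeroConstant ω y)
    (hz : IsZeroConstant ω z) : IsZeroConstant ω (y + z) := by
  obtain ⟨hy, hy'⟩ := hy
  obtain ⟨hz, hz'⟩ := hz
  refine ⟨add_mem hy hz, ?_⟩
  have : (⟨y + z, add_mem hy hz⟩ : moderateConstants ω) = ⟨y, hy⟩ + ⟨z, hz⟩ := rfl
  rw [this, map_add, hy', hz', add_zero]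

theorem isZeroConstant_of_negligible_sub {d : ℕ} {ω : WeightFunction}
    {Ω : TopologicalSpace.Opens (EuclideanSpace ℝ (Fin d))} (T : RoumieuUltradistribution ω Ω)
    {f g : Eps → roumieuFunctions ω Ω} (hfg : IsNegligibleNet ω Ω (g - f))
    (ρ : roumieuTestFunctions ω Ω)
    (hf : IsZeroConstant ω
      (fun ε => pairing (f ε : EuclideanSpace ℝ (Fin d) → ℂ) ρ - T.toLinearMap ρ)) :
    IsZeroConstant ω
      (fun ε => pairing (g ε : EuclideanSpace ℝ (Fin d) → ℂ) ρ - T.toLinearMap ρ) := by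
  have h := (isZeroConstant_pairing hfg ρ).add hf
  convert h using 1
  ext ε
  have : pairing ((g - f) ε : EuclideanSpace ℝ (Fin d) → ℂ) ρ =
      pairing (g ε : EuclideanSpace ℝ (Fin d) → ℂ) ρ -
        pairing (f ε : EuclideanSpace ℝ (Fin d) → ℂ) ρ := by
    rw [pairing, pairing, pairing,
      ← integral_sub (integrable_pairing (g ε) ρ) (integrable_pairing (f ε) ρ)]
    refine integral_congr_ae (Eventually.of_forall fun x => ?_)
    simp [sub_mul]
  simp only [Pi.add_apply]
  rw [this]
  ring

/-- Strict association: for `g = [(g_ε)]`, the generalized constant `[(⟨g_ε - T, ρ⟩)]` is zero for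
every test function `ρ`. -/
def StrictlyAssociated {d : ℕ} {ω : WeightFunction}
    {Ω : TopologicalSpace.Opens (EuclideanSpace ℝ (Fin d))}
    (T : RoumieuUltradistribution ω Ω) (g : RoumieuGeneralizedFunction ω Ω) : Prop :=
  Quotient.lift (s := moderateNetSetoid ω Ω)
    (fun f : {f : Eps → roumieuFunctions ω Ω // IsModerateNet ω Ω f} =>
      ∀ ρ : roumieuTestFunctions ω Ω, IsZeroConstant ω
        (fun ε => pairing (f.1 ε : EuclideanSpace ℝ (Fin d) → ℂ) ρ - T.toLinearMap ρ))
    (fun _ _ hfg => propext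
      ⟨fun h ρ => isZeroConstant_of_negligible_sub T
          ((moderateNetSetoid ω Ω).symm hfg) ρ (h ρ),
        fun h ρ => isZeroConstant_of_negligible_sub T hfg ρ (h ρ)⟩) g

end

/-! Fix a test function φ. The number F(ξ) = ⟨T, e^{-ix·ξ}φ⟩ plays the role of the Fourier transform
of φT, and ⟨g_ε, e^{-ix·ξ}φ⟩ is the Fourier transform of φg_ε. Two bounds hold for small ε,
uniformly in ξ. Regularity gives |(φg_ε)^(ξ)| ≤ A e^{kω(1/ε) - hω(|ξ|)} for every k > 0, with h
independent of k (`IsRegularNet.exists_norm_fhat_mul_le`). Strict association, a statement about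
each test function separately, becomes uniform on sets bounded in ‖·‖_l by Banach–Steinhaus
(`exists_uniform_negligible`), so that |(φg_ε)^(ξ) - F(ξ)| ≤ C e^{lω(|ξ|) - mω(1/ε)}. Here l > 0 can
be taken as small as desired, at the price of m.

Since ω is continuous and unbounded, ε can be coupled to ξ by ω(1/ε) = pω(|ξ|). With p large and
then k small, both bounds decay in ξ, hence F does (`exists_norm_limit_le`). The geometric mean of
the two bounds then shows that (φg_ε)^ - F decays both in ξ and in ε (`exists_norm_sub_limit_le`).

So φg_ε converges uniformly, and its limit has Fourier transform F and finite norm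
(`limit_of_fhat`). With cutoffs φ, the limits define a function f on Ω such that φf is a test
function for every φ. At ξ = 0 the identity (φf)^ = F reads ∫fφ = ⟨T, φ⟩. -/

/-! ### Growth of the weight -/

/-- As ω(t)/log(1+t) tends to infinity, it exceeds n/l beyond some R; on [0, |R|] the constant
(1+|R|)^n suffices. -/
theorem WeightFunction.exists_one_add_pow_le (ω : WeightFunction) {l : ℝ} (hl : 0 < l) (n : ℕ) :
    ∃ C : ℝ, 0 < C ∧ ∀ t, 0 ≤ t → (1 + t) ^ n ≤ C * Real.exp (l * ω t) := by
  obtain ⟨R, hR⟩ := eventually_atTop.1 (ω.tendsto'.eventually_ge_atTop (n / l))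
  refine ⟨(1 + |R|) ^ n, by positivity, fun t ht => ?_⟩
  have hω := mul_nonneg hl.le (ω.nonneg ht)
  rcases le_total t |R| with h | h
  · refine le_trans ?_ (le_mul_of_one_le_right (by positivity) (Real.one_le_exp hω))
    gcongr
  · rcases ht.eq_or_lt with rfl | ht0
    · rw [ω.map_zero']
      have : 1 ≤ (1 + |R|) ^ n := one_le_pow₀ (by linarith [abs_nonneg R])
      simpa using this
    have hlog : 0 < Real.log (1 + t) := Real.log_pos (by linarith)
    have h1 := hR t ((le_abs_self R).trans h)
    rw [div_le_div_iff₀ hl hlog] at h1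
    have h2 : (1 + t) ^ n ≤ Real.exp (l * ω t) := by
      rw [← Real.exp_log (show 0 < 1 + t by linarith), ← Real.exp_nat_mul]
      exact Real.exp_le_exp.2 (by linarith)
    exact h2.trans (le_mul_of_one_le_left (Real.exp_pos _).le
      (one_le_pow₀ (by linarith [abs_nonneg R])))

theorem WeightFunction.lintegral_exp_neg_lt_top (ω : WeightFunction) {d : ℕ} {c : ℝ} (hc : 0 < c) :
    ∫⁻ ξ : EuclideanSpace ℝ (Fin d), ENNReal.ofReal (Real.exp (-(c * ω ‖ξ‖))) < ⊤ := by
  -- The power d+1 exceeds the dimension, which makes (1+|ξ|)^{-(d+1)} integrable.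
  obtain ⟨C, hC, hω⟩ := ω.exists_one_add_pow_le hc (d + 1)
  have hi : Integrable (fun x : EuclideanSpace ℝ (Fin d) => C * (1 + ‖x‖) ^ (-((d + 1 : ℕ) : ℝ))) :=
    (integrable_one_add_norm (by simp)).const_mul C
  refine lt_of_le_of_lt (lintegral_mono fun ξ => ?_) hi.hasFiniteIntegral
  rw [← ofReal_norm]
  refine ENNReal.ofReal_le_ofReal (le_trans ?_ (le_abs_self _))
  dsimp only
  rw [Real.rpow_neg (by positivity), Real.rpow_natCast, Real.exp_neg,
    ← div_eq_mul_inv, le_div_iff₀ (by positivity), ← div_eq_inv_mul, div_le_iff₀ (Real.exp_pos _)]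
  exact hω _ (norm_nonneg _)

/-! ### Smoothness from a finite Fourier norm -/

theorem lintegral_fourier_lt_top {d : ℕ} {ω : WeightFunction} {l : ℝ}
    {f : EuclideanSpace ℝ (Fin d) → ℂ} (h : fourierNorm ω l f < ⊤) :
    ∫⁻ ξ, ‖𝓕 f ξ‖ₑ * ENNReal.ofReal (Real.exp (l * ω ‖(2 * Real.pi) • ξ‖)) < ⊤ := by
  rw [fourierNorm_eq] at h
  exact (le_mul_of_one_le_left zero_le (one_le_fourierConst d)).trans_lt h

theorem integrable_norm_pow_mul_fourier {d : ℕ} {ω : WeightFunction} {l : ℝ} (hl : 0 < l)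
    {f : EuclideanSpace ℝ (Fin d) → ℂ} (hf : Integrable f) (h : fourierNorm ω l f < ⊤) (n : ℕ) :
    Integrable (fun v => ‖v‖ ^ n * ‖𝓕 f v‖) := by
  have hc := continuous_fourier hf
  obtain ⟨C, hC, hω⟩ := ω.exists_one_add_pow_le hl n
  refine ⟨(by fun_prop : Continuous _).aestronglyMeasurable, ?_⟩
  have hfin := ENNReal.mul_lt_top (ENNReal.ofReal_lt_top (r := C)) (lintegral_fourier_lt_top h)
  rw [← lintegral_const_mul' _ _ ENNReal.ofReal_ne_top] at hfin
  refine lt_of_le_of_lt (lintegral_mono fun v => ?_) hfin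
  rw [enorm_mul, mul_comm, enorm_norm, mul_left_comm, ← ENNReal.ofReal_mul hC.le]
  gcongr
  rw [← ofReal_norm, Real.norm_of_nonneg (by positivity)]
  refine ENNReal.ofReal_le_ofReal (le_trans ?_ (hω _ (norm_nonneg _)))
  gcongr
  rw [norm_smul, Real.norm_of_nonneg (by positivity)]
  nlinarith [norm_nonneg v, Real.pi_gt_three]

/-- The weight absorbs every power of |ξ|, so Fourier inversion may be differentiated without limit.
This gives smoothness of sums of series and of limits that are known only to be continuous. -/
theorem contDiff_of_fourierNorm_lt_top {d : ℕ} {ω : WeightFunction} {l : ℝ} (hl : 0 < l)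
    {f : EuclideanSpace ℝ (Fin d) → ℂ} (hc : Continuous f) (hf : Integrable f)
    (h : fourierNorm ω l f < ⊤) : ContDiff ℝ ((⊤ : ℕ∞) : WithTop ℕ∞) f := by
  have hi : Integrable (𝓕 f) := by
    have := integrable_norm_pow_mul_fourier hl hf h 0
    simp only [pow_zero, one_mul] at this
    exact (integrable_norm_iff (continuous_fourier hf).aestronglyMeasurable).1 this
  have h2 : ContDiff ℝ ((⊤ : ℕ∞) : WithTop ℕ∞) (𝓕 (𝓕 f)) :=
    Real.contDiff_fourier fun n _ => integrable_norm_pow_mul_fourier hl hf h n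
  rw [← hc.fourierInv_fourier_eq hf hi]
  have h3 : 𝓕⁻ (𝓕 f) = fun x => 𝓕 (𝓕 f) (-x) :=
    funext fun x => Real.fourierInv_eq_fourier_neg _ _
  rw [h3]
  exact h2.comp contDiff_neg

/-! ### Pointwise decay of the Fourier transform -/

theorem norm_fhat_le {d : ℕ} {f : EuclideanSpace ℝ (Fin d) → ℂ}
    (ξ : EuclideanSpace ℝ (Fin d)) : ‖fhat f ξ‖ ≤ ∫ x, ‖f x‖ := by
  refine (norm_integral_le_integral_norm _).trans_eq (integral_congr_ae (ae_of_all _ fun x => ?_))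
  simp [Complex.norm_exp]

/-- Uses |e^{is} - 1| ≤ |s| with |s| = |x·(ξ-η)| ≤ R|ξ-η| on the support of f. -/
theorem norm_fhat_sub_le {d : ℕ} {f : EuclideanSpace ℝ (Fin d) → ℂ} (hf : Integrable f) {R : ℝ}
    (hR : ∀ x, f x ≠ 0 → ‖x‖ ≤ R) (ξ η : EuclideanSpace ℝ (Fin d)) :
    ‖fhat f ξ - fhat f η‖ ≤ R * ‖ξ - η‖ * ∫ x, ‖f x‖ := by
  rw [fhat, fhat, ← integral_sub (integrable_kernel hf ξ) (integrable_kernel hf η),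
    ← integral_const_mul]
  refine norm_integral_le_of_norm_le (hf.norm.const_mul _) (ae_of_all _ fun x => ?_)
  by_cases hx : f x = 0
  · simp [hx]
  rw [← sub_mul, norm_mul]
  gcongr
  have h1 : Complex.exp (-(Complex.I * (inner ℝ x ξ : ℝ))) -
      Complex.exp (-(Complex.I * (inner ℝ x η : ℝ))) =
      Complex.exp (-(Complex.I * (inner ℝ x η : ℝ))) *
        (Complex.exp (Complex.I * ((inner ℝ x (η - ξ) : ℝ) : ℂ)) - 1) := by
    rw [mul_sub, ← Complex.exp_add, inner_sub_right, mul_one]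
    congr 2
    push_cast
    ring
  rw [h1, norm_mul]
  have h2 : ‖Complex.exp (-(Complex.I * (inner ℝ x η : ℝ)))‖ = 1 := by simp [Complex.norm_exp]
  rw [h2, one_mul]
  refine Real.norm_exp_I_mul_ofReal_sub_one_le.trans ((norm_inner_le_norm _ _).trans ?_)
  rw [norm_sub_rev]
  gcongr
  exact hR x hx

theorem norm_le_toReal_fourierNorm {d : ℕ} {ω : WeightFunction} {l : ℝ} (hl : 0 ≤ l)
    {f : EuclideanSpace ℝ (Fin d) → ℂ}
    (hf : ContDiff ℝ ((⊤ : ℕ∞) : WithTop ℕ∞) f) (hfc : HasCompactSupport f)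
    (h : fourierNorm ω l f < ⊤) (x : EuclideanSpace ℝ (Fin d)) :
    ‖f x‖ ≤ (fourierNorm ω l f).toReal := by
  have := enorm_le_fourierNorm ω hl hf hfc x
  rw [← ofReal_norm] at this
  exact (ENNReal.ofReal_le_iff_le_toReal h.ne).1 this

theorem integral_norm_le_toReal_fourierNorm {d : ℕ} {ω : WeightFunction} {l : ℝ} (hl : 0 ≤ l)
    {K : Set (EuclideanSpace ℝ (Fin d))} (hK : IsCompact K)
    {f : EuclideanSpace ℝ (Fin d) → ℂ}
    (hf : ContDiff ℝ ((⊤ : ℕ∞) : WithTop ℕ∞) f) (hfc : HasCompactSupport f) (hfK : tsupport f ⊆ K)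
    (h : fourierNorm ω l f < ⊤) :
    ∫ x, ‖f x‖ ≤ volume.real K * (fourierNorm ω l f).toReal := by
  have h0 : ∫ x, ‖f x‖ = ∫ x in K, ‖f x‖ := by
    refine (setIntegral_eq_integral_of_forall_compl_eq_zero fun x hx => ?_).symm
    rw [image_eq_zero_of_notMem_tsupport fun h => hx (hfK h), norm_zero]
  rw [h0]
  have := norm_setIntegral_le_of_norm_le_const (μ := volume) (f := fun x => ‖f x‖) hK.measure_lt_top
    (fun x _ => by simpa using norm_le_toReal_fourierNorm hl hf hfc h x)
  rw [mul_comm]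
  exact (le_abs_self _).trans this

/-- A function of finite Fourier norm with support in a fixed compact set has a pointwise
exponential decay of its Fourier transform, because this transform is Lipschitz. -/
theorem exists_norm_fhat_le {d : ℕ} (ω : WeightFunction) {l : ℝ} (hl : 0 ≤ l)
    {K : Set (EuclideanSpace ℝ (Fin d))} (hK : IsCompact K) :
    ∃ C : ℝ, 0 ≤ C ∧ ∀ f : EuclideanSpace ℝ (Fin d) → ℂ,
      ContDiff ℝ ((⊤ : ℕ∞) : WithTop ℕ∞) f → tsupport f ⊆ K → fourierNorm ω l f < ⊤ → ∀ ξ,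
        ‖fhat f ξ‖ ≤ C * (fourierNorm ω l f).toReal * Real.exp (-(l / (d + 1) * ω ‖ξ‖)) := by
  obtain ⟨R, hR0, hR⟩ := hK.isBounded.exists_pos_norm_le
  set M := volume.real K with hM
  have hM0 : 0 ≤ M := measureReal_nonneg
  set L := M + R * M + 1 with hL
  have hL0 : 0 < L := by positivity
  set v := volume.real (Metric.ball (0 : EuclideanSpace ℝ (Fin d)) 1) with hv
  have hv0 : 0 < v := ENNReal.toReal_pos (Metric.measure_ball_pos _ _ one_pos).ne'
    measure_ball_lt_top.ne
  -- The second entry is what the integral over a small ball produces; C ≥ 1 permits C ≤ C^(d+1)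
  -- before the root is taken.
  set C := max 1 (2 * (2 * L) ^ d * Real.exp (l * ω 1) / v) with hC
  have hC1 : 1 ≤ C := le_max_left _ _
  refine ⟨C, by positivity, fun f hf hfK hfl ξ => ?_⟩
  have hfc : HasCompactSupport f := hK.of_isClosed_subset (isClosed_tsupport f) hfK
  have hfi : Integrable f := hf.continuous.integrable_of_hasCompactSupport hfc
  set N := (fourierNorm ω l f).toReal with hN
  have hint := integral_norm_le_toReal_fourierNorm hl hK hf hfc hfK hfl
  have hN0 : 0 ≤ N := ENNReal.toReal_nonneg
  set a := ‖fhat f ξ‖ with ha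
  have haN : a ≤ L * N := by
    refine (norm_fhat_le ξ).trans (hint.trans ?_)
    gcongr
    rw [hL]
    nlinarith
  rcases (norm_nonneg (fhat f ξ)).eq_or_lt with h0 | h0
  · rw [ha, ← h0]
    positivity
  have hNpos : 0 < N := by
    by_contra hcon
    have : N = 0 := le_antisymm (not_lt.1 hcon) hN0
    rw [this, mul_zero] at haN
    exact absurd h0 (not_lt.2 haN)
  -- The Lipschitz constant is at most R·M·N ≤ L·N, so on the ball of radius r the transform varies
  -- by at most a/2. From a ≤ L·N comes r ≤ 1.
  set r := a / (2 * L * N) with hr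
  have hr0 : 0 < r := by positivity
  have hr1 : r ≤ 1 := by
    rw [hr, div_le_one (by positivity)]
    nlinarith
  have hball : ∀ η ∈ Metric.ball ξ r,
      a / 2 * Real.exp (l * (ω ‖ξ‖ - ω 1)) ≤ ‖fhat f η‖ * Real.exp (l * ω ‖η‖) := by
    intro η hη
    rw [Metric.mem_ball, dist_eq_norm] at hη
    have h1 : ‖fhat f ξ - fhat f η‖ ≤ a / 2 := by
      refine (norm_fhat_sub_le hfi (R := R)
        (fun x hx => hR x (hfK (subset_tsupport f hx))) ξ η).trans ?_
      calc R * ‖ξ - η‖ * ∫ x, ‖f x‖ ≤ R * r * (M * N) := by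
            rw [norm_sub_rev]
            gcongr
        _ ≤ L * r * N := by
            have : R * M ≤ L := by rw [hL]; linarith
            calc _ = (R * M) * (r * N) := by ring
              _ ≤ L * (r * N) := by gcongr
              _ = _ := by ring
        _ = a / 2 := by
            rw [hr]
            field_simp
    have h2 : a / 2 ≤ ‖fhat f η‖ := by
      have := norm_sub_norm_le (fhat f ξ) (fhat f η)
      linarith
    gcongr
    have h3 : ω ‖ξ‖ ≤ ω (‖η‖ + 1) := by
      refine ω.monotoneOn' (norm_nonneg _) (Set.mem_Ici.2 (by positivity)) ?_
      have := norm_sub_norm_le ξ η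
      rw [norm_sub_rev] at this
      linarith
    have := ω.subadditive' ‖η‖ 1 (norm_nonneg _) zero_le_one
    linarith
  have hvol : volume.real (Metric.ball ξ r) = r ^ d * v := by
    rw [measureReal_def, Measure.addHaar_ball_of_pos _ _ hr0, ENNReal.toReal_mul,
      ENNReal.toReal_ofReal (by positivity), finrank_euclideanSpace, Fintype.card_fin]
    rfl
  -- The part of the norm carried by the ball is at most N. As r is proportional to a/N, this bounds
  -- (a/N)^(d+1), and the (d+1)-st root turns the rate l into l/(d+1).
  have hmain : a / 2 * Real.exp (l * (ω ‖ξ‖ - ω 1)) * (r ^ d * v) ≤ N := by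
    rw [hN, ← ENNReal.ofReal_le_iff_le_toReal hfl.ne, ENNReal.ofReal_mul (by positivity), ← hvol,
      ofReal_measureReal measure_ball_lt_top.ne, ← setLIntegral_const]
    refine le_trans (setLIntegral_mono' Metric.isOpen_ball.measurableSet fun η hη => ?_)
      (setLIntegral_le_lintegral (Metric.ball ξ r) _)
    rw [← ofReal_norm, ← ENNReal.ofReal_mul (norm_nonneg _)]
    exact ENNReal.ofReal_le_ofReal (hball η hη)
  have hpow : (a / N) ^ (d + 1) ≤ (C * Real.exp (-(l / (d + 1) * ω ‖ξ‖))) ^ (d + 1) := by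
    have e1 : Real.exp (-(l / (d + 1) * ω ‖ξ‖)) ^ (d + 1) = Real.exp (-(l * ω ‖ξ‖)) := by
      rw [← Real.exp_nat_mul]
      congr 1
      push_cast
      field_simp
    have e2 : Real.exp (l * (ω ‖ξ‖ - ω 1)) =
        (Real.exp (l * ω 1))⁻¹ * (Real.exp (-(l * ω ‖ξ‖)))⁻¹ := by
      rw [← Real.exp_neg, ← Real.exp_neg, ← Real.exp_add]
      ring_nf
    rw [mul_pow, e1]
    have e3 : (a / N) ^ (d + 1) ≤ C * Real.exp (-(l * ω ‖ξ‖)) := by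
      have hCle : 2 * (2 * L) ^ d * Real.exp (l * ω 1) / v ≤ C := le_max_right _ _
      refine le_trans ?_ (mul_le_mul_of_nonneg_right hCle (Real.exp_pos _).le)
      rw [e2, hr, div_pow, mul_pow] at hmain
      rw [div_pow, pow_succ, pow_succ N, div_mul_eq_mul_div, div_le_div_iff₀ (by positivity) hv0]
      have e4 : a / 2 * ((Real.exp (l * ω 1))⁻¹ * (Real.exp (-(l * ω ‖ξ‖)))⁻¹) *
          (a ^ d / ((2 * L) ^ d * N ^ d) * v) =
          a ^ d * a * v / (2 * (2 * L) ^ d * Real.exp (l * ω 1) *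
            Real.exp (-(l * ω ‖ξ‖)) * N ^ d) := by
        field_simp
      rw [e4, div_le_iff₀ (by positivity)] at hmain
      linarith
    refine e3.trans (mul_le_mul_of_nonneg_right ?_ (Real.exp_pos _).le)
    exact le_self_pow₀ hC1 (by simp)
  have := (pow_le_pow_iff_left₀ (by positivity) (by positivity) (by simp)).1 hpow
  rw [div_le_iff₀ hNpos] at this
  linarith

/-! ### Modulated test functions -/

/-- The modulation `e^{-i x·ξ} φ(x)`. -/
noncomputable def modulate {d : ℕ} (ξ : EuclideanSpace ℝ (Fin d))
    (φ : EuclideanSpace ℝ (Fin d) → ℂ) : EuclideanSpace ℝ (Fin d) → ℂ :=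
  fun x => Complex.exp (-(Complex.I * (inner ℝ x ξ : ℝ))) * φ x

theorem fhat_modulate {d : ℕ} (ξ η : EuclideanSpace ℝ (Fin d))
    (φ : EuclideanSpace ℝ (Fin d) → ℂ) : fhat (modulate ξ φ) η = fhat φ (η + ξ) := by
  refine integral_congr_ae (ae_of_all _ fun x => ?_)
  simp only [modulate]
  rw [← mul_assoc, ← Complex.exp_add, inner_add_right]
  congr 2
  push_cast
  ring

/-- Modulation translates the Fourier transform by ξ, and subadditivity bounds the resulting change
of weight by e^{lω(|ξ|)}. -/
theorem fourierNorm_modulate_le {d : ℕ} (ω : WeightFunction) {l : ℝ} (hl : 0 ≤ l)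
    (ξ : EuclideanSpace ℝ (Fin d)) (φ : EuclideanSpace ℝ (Fin d) → ℂ) :
    fourierNorm ω l (modulate ξ φ) ≤
      ENNReal.ofReal (Real.exp (l * ω ‖ξ‖)) * fourierNorm ω l φ := by
  have h := lintegral_add_right_eq_self (μ := volume)
    (fun η => ‖fhat φ η‖ₑ * ENNReal.ofReal (Real.exp (l * ω ‖η‖))) ξ
  rw [fourierNorm, fourierNorm, ← h, ← lintegral_const_mul' _ _ ENNReal.ofReal_ne_top]
  refine lintegral_mono fun η => ?_
  rw [fhat_modulate, mul_left_comm, ← ENNReal.ofReal_mul (Real.exp_pos _).le, ← Real.exp_add,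
    ← mul_add]
  gcongr
  refine le_trans ?_ (ω.subadditive' _ _ (norm_nonneg _) (norm_nonneg _))
  refine ω.monotoneOn' (norm_nonneg _) (Set.mem_Ici.2 (by positivity)) ?_
  have := norm_sub_le (η + ξ) ξ
  rw [add_sub_cancel_right] at this
  linarith

theorem tsupport_modulate_subset {d : ℕ} (ξ : EuclideanSpace ℝ (Fin d))
    (φ : EuclideanSpace ℝ (Fin d) → ℂ) : tsupport (modulate ξ φ) ⊆ tsupport φ :=
  tsupport_mul_subset_right (f := fun x => Complex.exp (-(Complex.I * (inner ℝ x ξ : ℝ))))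

theorem modulate_mem {d : ℕ} {ω : WeightFunction}
    {Ω : TopologicalSpace.Opens (EuclideanSpace ℝ (Fin d))} (ξ : EuclideanSpace ℝ (Fin d))
    {φ : EuclideanSpace ℝ (Fin d) → ℂ} (hφ : φ ∈ roumieuTestFunctions ω Ω) :
    modulate ξ φ ∈ roumieuTestFunctions ω Ω := by
  obtain ⟨hs, hc, hΩ, l, hl, hfin⟩ := hφ
  refine ⟨?_, hc.mul_left, (tsupport_modulate_subset ξ φ).trans hΩ, l, hl,
    (fourierNorm_modulate_le ω hl.le ξ φ).trans_lt (ENNReal.mul_lt_top ENNReal.ofReal_lt_top hfin)⟩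
  refine ContDiff.mul (Complex.contDiff_exp.comp (ContDiff.neg (contDiff_const.mul ?_))) hs
  exact Complex.ofRealCLM.contDiff.comp (contDiff_id.inner ℝ contDiff_const)

/-- The link between weak information, tested on modulated functions, and the size of Fourier
transforms. -/
theorem pairing_modulate {d : ℕ} (g φ : EuclideanSpace ℝ (Fin d) → ℂ)
    (ξ : EuclideanSpace ℝ (Fin d)) : pairing g (modulate ξ φ) = fhat (φ * g) ξ := by
  refine integral_congr_ae (ae_of_all _ fun x => ?_)
  simp only [modulate, Pi.mul_apply]
  ring

/-! ### Absolutely convergent series of test functions -/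

section Series

variable {d : ℕ} {ω : WeightFunction} {Ω : TopologicalSpace.Opens (EuclideanSpace ℝ (Fin d))}
  {K : Set (EuclideanSpace ℝ (Fin d))} {l : ℝ} {ρ : ℕ → roumieuTestFunctions ω Ω} {a : ℕ → ℂ}

theorem norm_le_one_of_fourierNorm_le_one (hl : 0 < l)
    (hρ : ∀ n, fourierNorm ω l (ρ n : EuclideanSpace ℝ (Fin d) → ℂ) ≤ 1) (n : ℕ)
    (x : EuclideanSpace ℝ (Fin d)) : ‖(ρ n : EuclideanSpace ℝ (Fin d) → ℂ) x‖ ≤ 1 := by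
  have := (enorm_le_fourierNorm ω hl.le (ρ n).2.1 (ρ n).2.2.1 x).trans (hρ n)
  rwa [← ofReal_norm, ENNReal.ofReal_le_one] at this

theorem summable_mul_test (hl : 0 < l)
    (hρ : ∀ n, fourierNorm ω l (ρ n : EuclideanSpace ℝ (Fin d) → ℂ) ≤ 1)
    (ha : Summable fun n => ‖a n‖) (x : EuclideanSpace ℝ (Fin d)) :
    Summable fun n => a n * (ρ n : EuclideanSpace ℝ (Fin d) → ℂ) x := by
  refine Summable.of_norm_bounded ha fun n => ?_
  rw [norm_mul]
  exact mul_le_of_le_one_right (norm_nonneg _) (norm_le_one_of_fourierNorm_le_one hl hρ n x)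

theorem continuous_tsum_test (hl : 0 < l)
    (hρ : ∀ n, fourierNorm ω l (ρ n : EuclideanSpace ℝ (Fin d) → ℂ) ≤ 1)
    (ha : Summable fun n => ‖a n‖) :
    Continuous fun x => ∑' n, a n * (ρ n : EuclideanSpace ℝ (Fin d) → ℂ) x := by
  refine continuous_tsum (fun n => continuous_const.mul (ρ n).2.1.continuous) ha fun n x => ?_
  rw [norm_mul]
  exact mul_le_of_le_one_right (norm_nonneg _) (norm_le_one_of_fourierNorm_le_one hl hρ n x)

theorem tsupport_tsum_test_subset (hK : IsCompact K)
    (hρK : ∀ n, tsupport (ρ n : EuclideanSpace ℝ (Fin d) → ℂ) ⊆ K) :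
    tsupport (fun x => ∑' n, a n * (ρ n : EuclideanSpace ℝ (Fin d) → ℂ) x) ⊆ K := by
  refine closure_minimal (fun x hx => ?_) hK.isClosed
  by_contra hxK
  refine hx ?_
  have : ∀ n, (ρ n : EuclideanSpace ℝ (Fin d) → ℂ) x = 0 := fun n =>
    image_eq_zero_of_notMem_tsupport fun h => hxK (hρK n h)
  simp [this]

theorem hasSum_fhat_tsum_test (hl : 0 < l) (hK : IsCompact K)
    (hρK : ∀ n, tsupport (ρ n : EuclideanSpace ℝ (Fin d) → ℂ) ⊆ K)
    (hρ : ∀ n, fourierNorm ω l (ρ n : EuclideanSpace ℝ (Fin d) → ℂ) ≤ 1)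
    (ha : Summable fun n => ‖a n‖) (ξ : EuclideanSpace ℝ (Fin d)) :
    HasSum (fun n => a n * fhat (ρ n) ξ)
      (fhat (fun x => ∑' n, a n * (ρ n : EuclideanSpace ℝ (Fin d) → ℂ) x) ξ) := by
  have hi : ∀ n, Integrable (ρ n : EuclideanSpace ℝ (Fin d) → ℂ) := fun n =>
    (ρ n).2.1.continuous.integrable_of_hasCompactSupport (ρ n).2.2.1
  have h := hasSum_integral_of_summable_integral_norm (μ := volume)
    (F := fun n x => Complex.exp (-(Complex.I * (inner ℝ x ξ : ℝ))) *
      (a n * (ρ n : EuclideanSpace ℝ (Fin d) → ℂ) x))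
    (fun n => integrable_kernel ((hi n).const_mul _) ξ) ?_
  · have e1 : (fun n => a n * fhat (ρ n) ξ) = fun n =>
        ∫ x, Complex.exp (-(Complex.I * (inner ℝ x ξ : ℝ))) *
          (a n * (ρ n : EuclideanSpace ℝ (Fin d) → ℂ) x) := by
      ext n
      rw [← fhat_smul]
      rfl
    have e2 : fhat (fun x => ∑' n, a n * (ρ n : EuclideanSpace ℝ (Fin d) → ℂ) x) ξ =
        ∫ x, ∑' n, Complex.exp (-(Complex.I * (inner ℝ x ξ : ℝ))) *
          (a n * (ρ n : EuclideanSpace ℝ (Fin d) → ℂ) x) :=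
      integral_congr_ae (ae_of_all _ fun x => tsum_mul_left.symm)
    rwa [e1, e2]
  · refine Summable.of_nonneg_of_le (fun n => integral_nonneg fun x => norm_nonneg _) (fun n => ?_)
      (ha.mul_right (volume.real K))
    have e : ∀ x, ‖Complex.exp (-(Complex.I * (inner ℝ x ξ : ℝ))) *
        (a n * (ρ n : EuclideanSpace ℝ (Fin d) → ℂ) x)‖ =
        ‖a n‖ * ‖(ρ n : EuclideanSpace ℝ (Fin d) → ℂ) x‖ := fun x => by simp [Complex.norm_exp]
    simp only [e, integral_const_mul]
    gcongr
    refine (integral_norm_le_toReal_fourierNorm hl.le hK (ρ n).2.1 (ρ n).2.2.1 (hρK n)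
      ((hρ n).trans_lt ENNReal.one_lt_top)).trans ?_
    refine mul_le_of_le_one_right measureReal_nonneg ?_
    exact ENNReal.toReal_le_of_le_ofReal zero_le_one (by simpa using hρ n)

/-- Fourier transform and sum commute by absolute convergence, so the norm is countably subadditive
here. Thus ℓ¹ maps into test functions with support in K and finite l-norm. -/
theorem fourierNorm_tsum_test_le (hl : 0 < l) (hK : IsCompact K)
    (hρK : ∀ n, tsupport (ρ n : EuclideanSpace ℝ (Fin d) → ℂ) ⊆ K)
    (hρ : ∀ n, fourierNorm ω l (ρ n : EuclideanSpace ℝ (Fin d) → ℂ) ≤ 1)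
    (ha : Summable fun n => ‖a n‖) :
    fourierNorm ω l (fun x => ∑' n, a n * (ρ n : EuclideanSpace ℝ (Fin d) → ℂ) x) ≤
      ENNReal.ofReal (∑' n, ‖a n‖) := by
  have hi : ∀ n, Integrable (ρ n : EuclideanSpace ℝ (Fin d) → ℂ) := fun n =>
    (ρ n).2.1.continuous.integrable_of_hasCompactSupport (ρ n).2.2.1
  have hw : Measurable fun ξ : EuclideanSpace ℝ (Fin d) =>
      ENNReal.ofReal (Real.exp (l * ω ‖ξ‖)) := by
    have := (ω.continuous_norm (V := EuclideanSpace ℝ (Fin d))).measurable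
    fun_prop
  calc _ ≤ ∫⁻ ξ, ∑' n, ‖a n‖ₑ * (‖fhat (ρ n : EuclideanSpace ℝ (Fin d) → ℂ) ξ‖ₑ *
          ENNReal.ofReal (Real.exp (l * ω ‖ξ‖))) := by
        refine lintegral_mono fun ξ => ?_
        simp only [← mul_assoc, ENNReal.tsum_mul_right, ← enorm_mul]
        gcongr
        rw [← (hasSum_fhat_tsum_test hl hK hρK hρ ha ξ).tsum_eq]
        exact enorm_tsum_le_tsum_enorm
    _ = ∑' n, ‖a n‖ₑ * fourierNorm ω l (ρ n : EuclideanSpace ℝ (Fin d) → ℂ) := by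
        rw [lintegral_tsum fun n => ?_]
        · refine tsum_congr fun n => ?_
          rw [lintegral_const_mul' _ _ enorm_ne_top, fourierNorm]
        · have := (continuous_fhat (hi n)).measurable
          fun_prop
    _ ≤ ∑' n, ‖a n‖ₑ := ENNReal.tsum_le_tsum fun n => mul_le_of_le_one_right zero_le (hρ n)
    _ = _ := by
        rw [ENNReal.ofReal_tsum_of_nonneg (fun n => norm_nonneg _) ha]
        simp only [ofReal_norm]

theorem summable_norm_lp_one (a : lp (fun _ : ℕ => ℂ) 1) : Summable fun n => ‖a n‖ := by
  simpa using (lp.memℓp a).summable (by simp)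

theorem norm_lp_one_eq (a : lp (fun _ : ℕ => ℂ) 1) : ‖a‖ = ∑' n, ‖a n‖ := by
  simpa using lp.norm_eq_tsum_rpow (by simp) a

/-- The linear map `a ↦ ∑ aₙ ρₙ` from `ℓ¹` to the test functions, for a bounded sequence `ρₙ`. -/
noncomputable def testSeries (hl : 0 < l) (hK : IsCompact K) (hKΩ : K ⊆ Ω)
    (hρK : ∀ n, tsupport (ρ n : EuclideanSpace ℝ (Fin d) → ℂ) ⊆ K)
    (hρ : ∀ n, fourierNorm ω l (ρ n : EuclideanSpace ℝ (Fin d) → ℂ) ≤ 1) :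
    lp (fun _ : ℕ => ℂ) 1 →ₗ[ℂ] roumieuTestFunctions ω Ω where
  toFun a := ⟨fun x => ∑' n, a n * (ρ n : EuclideanSpace ℝ (Fin d) → ℂ) x, by
    have hs := summable_norm_lp_one a
    have hc := continuous_tsum_test hl hρ hs
    have hK' := tsupport_tsum_test_subset (a := a) hK hρK
    have hcs := hK.of_isClosed_subset (isClosed_tsupport _) hK'
    have hfin := (fourierNorm_tsum_test_le hl hK hρK hρ hs).trans_lt ENNReal.ofReal_lt_top
    exact ⟨contDiff_of_fourierNorm_lt_top hl hc (hc.integrable_of_hasCompactSupport hcs) hfin,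
      hcs, hK'.trans hKΩ, l, hl, hfin⟩⟩
  map_add' a b := by
    refine Subtype.ext (funext fun x => ?_)
    have h1 := summable_mul_test hl hρ (summable_norm_lp_one a) x
    have h2 := summable_mul_test hl hρ (summable_norm_lp_one b) x
    simp only [lp.coeFn_add, Pi.add_apply, add_mul, Submodule.coe_add]
    exact h1.tsum_add h2
  map_smul' c a := by
    refine Subtype.ext (funext fun x => ?_)
    simp only [lp.coeFn_smul, Pi.smul_apply, smul_eq_mul, mul_assoc, Submodule.coe_smul,
      RingHom.id_apply]
    exact tsum_mul_left

theorem testSeries_single (hl : 0 < l) (hK : IsCompact K) (hKΩ : K ⊆ Ω)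
    (hρK : ∀ n, tsupport (ρ n : EuclideanSpace ℝ (Fin d) → ℂ) ⊆ K)
    (hρ : ∀ n, fourierNorm ω l (ρ n : EuclideanSpace ℝ (Fin d) → ℂ) ≤ 1) (n : ℕ) :
    testSeries hl hK hKΩ hρK hρ (lp.single 1 n 1) = ρ n := by
  refine Subtype.ext (funext fun x => ?_)
  change ∑' k, lp.single (E := fun _ : ℕ => ℂ) 1 n (1 : ℂ) k *
    (ρ k : EuclideanSpace ℝ (Fin d) → ℂ) x = _
  rw [tsum_eq_single n fun k hk => ?_]
  · rw [lp.single_apply_self, one_mul]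
  · rw [lp.single_apply_ne _ _ _ hk, zero_mul]

end Series

/-! ### The parameter ε measured by ω(1/ε) -/

theorem exists_forall_weight_of_eventually (ω : WeightFunction) {P : Eps → Prop}
    (h : ∀ᶠ ε in epsToZero, P ε) : ∃ s : ℝ, 0 < s ∧ ∀ ε : Eps, s < ω (1 / (ε : ℝ)) → P ε := by
  obtain ⟨t, ht, htP⟩ := mem_comap.1 h
  obtain ⟨δ, hδ, hδt⟩ := Metric.mem_nhds_iff.1 ht
  -- The added 1 only secures positivity of the threshold.
  refine ⟨ω (1 / δ) + 1, by linarith [ω.nonneg (t := 1 / δ) (by positivity)],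
    fun ε hε => htP (hδt ?_)⟩
  rw [Metric.mem_ball, dist_zero_right, Real.norm_of_nonneg ε.2.1.le]
  by_contra hcon
  have : ω (1 / (ε : ℝ)) ≤ ω (1 / δ) :=
    ω.monotoneOn' (Set.mem_Ici.2 ε.inv_nonneg) (Set.mem_Ici.2 (by positivity))
      (one_div_le_one_div_of_le hδ (not_lt.1 hcon))
  linarith

/-- Intermediate value theorem for ω; s > ω(1) forces 1/ε > 1, hence ε < 1. -/
theorem exists_eps_weight_eq (ω : WeightFunction) {s : ℝ} (hs : ω 1 < s) :
    ∃ ε : Eps, ω (1 / (ε : ℝ)) = s := by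
  obtain ⟨b, hb1, hb⟩ := ((eventually_ge_atTop 1).and
    (ω.tendsto_atTop.eventually_ge_atTop s)).exists
  obtain ⟨t, ht, hts⟩ := intermediate_value_Icc hb1
    (ω.continuousOn'.mono fun x hx => Set.mem_Ici.2 (zero_le_one.trans hx.1)) ⟨hs.le, hb⟩
  have ht1 : 1 < t := by
    refine lt_of_le_of_ne ht.1 fun h => ?_
    rw [← h] at hts
    exact hs.ne hts
  refine ⟨⟨t⁻¹, inv_pos.2 (by linarith), inv_lt_one_of_one_lt₀ ht1⟩, ?_⟩
  simpa using hts

instance epsToZero_neBot : epsToZero.NeBot := by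
  rw [epsToZero, comap_neBot_iff]
  intro t ht
  obtain ⟨δ, hδ, hδt⟩ := Metric.mem_nhds_iff.1 ht
  refine ⟨⟨min (δ / 2) (1 / 2), by positivity, (min_le_right _ _).trans_lt (by norm_num)⟩, hδt ?_⟩
  have h1 : 0 < min (δ / 2) (1 / 2) := by positivity
  rw [Metric.mem_ball, Real.dist_eq, sub_zero, abs_of_pos h1]
  exact (min_le_left _ _).trans_lt (by linarith)

instance epsToZero_isCountablyGenerated : epsToZero.IsCountablyGenerated := by
  unfold epsToZero
  infer_instance

theorem IsLittleOExp.eventually_le {ω : WeightFunction} {k : ℝ} {N : Eps → ℝ≥0∞}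
    (h : IsLittleOExp ω k N) :
    ∀ᶠ ε in epsToZero, N ε ≤ ENNReal.ofReal (Real.exp (k * ω (1 / (ε : ℝ)))) := by
  have h1 : ∀ᶠ ε in epsToZero, N ε * ENNReal.ofReal (Real.exp (-(k * ω (1 / (ε : ℝ))))) < 1 :=
    (tendsto_order.1 h).2 1 one_pos
  filter_upwards [h1] with ε hε
  have e : ENNReal.ofReal (Real.exp (-(k * ω (1 / (ε : ℝ))))) *
      ENNReal.ofReal (Real.exp (k * ω (1 / (ε : ℝ)))) = 1 := by
    rw [← ENNReal.ofReal_mul (Real.exp_pos _).le, ← Real.exp_add]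
    simp
  calc N ε = N ε * ENNReal.ofReal (Real.exp (-(k * ω (1 / (ε : ℝ))))) *
        ENNReal.ofReal (Real.exp (k * ω (1 / (ε : ℝ)))) := by rw [mul_assoc, e, mul_one]
    _ ≤ 1 * ENNReal.ofReal (Real.exp (k * ω (1 / (ε : ℝ)))) := by gcongr
    _ = _ := one_mul _

/-! ### Uniform negligibility by Banach–Steinhaus -/

/-- Nets of bounded functionals that are negligible at every test function are uniformly
negligible on the bounded sets of test functions, by the Banach–Steinhaus theorem. -/
theorem exists_uniform_negligible_of_le_one {d : ℕ} {ω : WeightFunction}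
    {Ω : TopologicalSpace.Opens (EuclideanSpace ℝ (Fin d))}
    {K : Set (EuclideanSpace ℝ (Fin d))} (hK : IsCompact K) (hKΩ : K ⊆ Ω) {l : ℝ} (hl : 0 < l)
    (u : Eps → roumieuTestFunctions ω Ω →ₗ[ℂ] ℂ)
    (hu : ∀ ε, ∃ B : ℝ, 0 ≤ B ∧ ∀ ρ : roumieuTestFunctions ω Ω,
      tsupport (ρ : EuclideanSpace ℝ (Fin d) → ℂ) ⊆ K →
      fourierNorm ω l (ρ : EuclideanSpace ℝ (Fin d) → ℂ) < ⊤ →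
        ‖u ε ρ‖ ≤ B * (fourierNorm ω l (ρ : EuclideanSpace ℝ (Fin d) → ℂ)).toReal)
    (hneg : ∀ ρ, ∃ m : ℝ, 0 < m ∧ IsLittleOExp ω (-m) (fun ε => ‖u ε ρ‖ₑ)) :
    ∃ m : ℝ, 0 < m ∧ ∃ C : ℝ, 0 ≤ C ∧ ∀ᶠ ε in epsToZero, ∀ ρ : roumieuTestFunctions ω Ω,
      tsupport (ρ : EuclideanSpace ℝ (Fin d) → ℂ) ⊆ K →
      fourierNorm ω l (ρ : EuclideanSpace ℝ (Fin d) → ℂ) ≤ 1 →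
        ‖u ε ρ‖ ≤ C * Real.exp (-(m * ω (1 / (ε : ℝ)))) := by
  by_contra! hcon
  -- Failure with rate 1/(n+1) and constant n gives a bad test function ρₙ at a parameter εₙ, taken
  -- below 1/(n+1) so that εₙ → 0.
  have hev : ∀ n : ℕ, ∃ ε : Eps, (ε : ℝ) < 1 / ((n : ℝ) + 1) ∧ ∃ ρ : roumieuTestFunctions ω Ω,
      tsupport (ρ : EuclideanSpace ℝ (Fin d) → ℂ) ⊆ K ∧
      fourierNorm ω l (ρ : EuclideanSpace ℝ (Fin d) → ℂ) ≤ 1 ∧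
        (n : ℝ) * Real.exp (-(1 / ((n : ℝ) + 1) * ω (1 / (ε : ℝ)))) < ‖u ε ρ‖ := by
    intro n
    have h1 := hcon (1 / ((n : ℝ) + 1)) (by positivity) n (by positivity)
    have h2 : ∀ᶠ ε : Eps in epsToZero, (ε : ℝ) < 1 / ((n : ℝ) + 1) :=
      tendsto_comap.eventually (gt_mem_nhds (by positivity))
    obtain ⟨ε, hε, hε'⟩ := (h1.and_eventually h2).exists
    exact ⟨ε, hε', hε⟩
  choose ε hε ρ hρK hρ1 hbig using hev
  have hlim : Tendsto ε atTop epsToZero := by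
    rw [epsToZero, tendsto_comap_iff]
    exact squeeze_zero (fun n => (ε n).2.1.le) (fun n => (hε n).le)
      tendsto_one_div_add_atTop_nhds_zero_nat
  -- Banach–Steinhaus is applied on the complete space ℓ¹, whose unit vectors are sent by S to the
  -- ρₙ.
  set S := testSeries hl hK hKΩ hρK hρ1 with hS
  have hSK : ∀ a, tsupport (S a : EuclideanSpace ℝ (Fin d) → ℂ) ⊆ K := fun a =>
    tsupport_tsum_test_subset hK hρK
  have hSn : ∀ a, fourierNorm ω l (S a : EuclideanSpace ℝ (Fin d) → ℂ) ≤ ENNReal.ofReal ‖a‖ := by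
    intro a
    rw [norm_lp_one_eq]
    exact fourierNorm_tsum_test_le hl hK hρK hρ1 (summable_norm_lp_one a)
  choose B hB0 hB using hu
  have hbd : ∀ n a, ‖(u (ε n) ∘ₗ S) a‖ ≤ B (ε n) * ‖a‖ := by
    intro n a
    refine (hB (ε n) (S a) (hSK a) ((hSn a).trans_lt ENNReal.ofReal_lt_top)).trans ?_
    gcongr
    · exact hB0 _
    · exact ENNReal.toReal_le_of_le_ofReal (norm_nonneg _) (hSn a)
  set E : ℕ → ℝ := fun n => Real.exp (1 / ((n : ℝ) + 1) * ω (1 / (ε n : ℝ))) with hE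
  set v : ℕ → lp (fun _ : ℕ => ℂ) 1 →L[ℂ] ℂ := fun n =>
    ((E n : ℝ) : ℂ) • (u (ε n) ∘ₗ S).mkContinuous (B (ε n)) (hbd n) with hv
  have hva : ∀ n a, ‖v n a‖ = E n * ‖u (ε n) (S a)‖ := by
    intro n a
    change ‖((E n : ℝ) : ℂ) • u (ε n) (S a)‖ = _
    rw [norm_smul, Complex.norm_real, Real.norm_of_nonneg (Real.exp_pos _).le]
  -- For fixed a the single test function S a has some rate m of negligibility, and the factor `E
  -- n`, of rate 1/(n+1), is eventually weaker. The finitely many remaining n are harmless.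
  have hbounded : ∀ a, ∃ C, ∀ n, ‖v n a‖ ≤ C := by
    intro a
    obtain ⟨m, hm, hma⟩ := hneg (S a)
    have h1 : ∀ᶠ n in atTop, ‖v n a‖ ≤ 1 := by
      have h2 : ∀ᶠ n : ℕ in atTop, 1 / ((n : ℝ) + 1) < m :=
        tendsto_one_div_add_atTop_nhds_zero_nat.eventually (gt_mem_nhds hm)
      filter_upwards [hlim.eventually hma.eventually_le, h2] with n hn hnm
      rw [← ofReal_norm, ENNReal.ofReal_le_ofReal_iff (Real.exp_pos _).le] at hn
      rw [hva]
      calc _ ≤ Real.exp (m * ω (1 / (ε n : ℝ))) * Real.exp (-m * ω (1 / (ε n : ℝ))) := by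
            have := ω.nonneg (ε n).inv_nonneg
            simp only [hE]
            gcongr
        _ = 1 := by
            rw [← Real.exp_add]
            simp
    obtain ⟨n₀, hn₀⟩ := eventually_atTop.1 h1
    obtain ⟨C, hC⟩ := ((Set.finite_Iio n₀).image fun n => ‖v n a‖).bddAbove
    refine ⟨max C 1, fun n => ?_⟩
    rcases lt_or_ge n n₀ with h | h
    · exact (hC ⟨n, h, rfl⟩).trans (le_max_left _ _)
    · exact (hn₀ n h).trans (le_max_right _ _)
  obtain ⟨C, hC⟩ := banach_steinhaus hbounded
  obtain ⟨n, hn⟩ := exists_nat_gt C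
  -- At the n-th unit vector the functional exceeds n by the choice of ρₙ, while n was taken above
  -- the uniform bound C.
  have h1 : ‖v n (lp.single 1 n 1)‖ ≤ C := by
    have := ((v n).le_opNorm (lp.single 1 n 1))
    rw [lp.norm_single one_pos, norm_one, mul_one] at this
    exact this.trans (hC n)
  rw [hva, hS, testSeries_single] at h1
  have h2 := mul_lt_mul_of_pos_left (hbig n) (Real.exp_pos (1 / ((n : ℝ) + 1) * ω (1 / (ε n : ℝ))))
  rw [mul_left_comm, ← Real.exp_add, add_neg_cancel, Real.exp_zero, mul_one] at h2
  linarith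

theorem exists_uniform_negligible {d : ℕ} {ω : WeightFunction}
    {Ω : TopologicalSpace.Opens (EuclideanSpace ℝ (Fin d))}
    {K : Set (EuclideanSpace ℝ (Fin d))} (hK : IsCompact K) (hKΩ : K ⊆ Ω) {l : ℝ} (hl : 0 < l)
    (u : Eps → roumieuTestFunctions ω Ω →ₗ[ℂ] ℂ)
    (hu : ∀ ε, ∃ B : ℝ, 0 ≤ B ∧ ∀ ρ : roumieuTestFunctions ω Ω,
      tsupport (ρ : EuclideanSpace ℝ (Fin d) → ℂ) ⊆ K →
      fourierNorm ω l (ρ : EuclideanSpace ℝ (Fin d) → ℂ) < ⊤ →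
        ‖u ε ρ‖ ≤ B * (fourierNorm ω l (ρ : EuclideanSpace ℝ (Fin d) → ℂ)).toReal)
    (hneg : ∀ ρ, ∃ m : ℝ, 0 < m ∧ IsLittleOExp ω (-m) (fun ε => ‖u ε ρ‖ₑ)) :
    ∃ m : ℝ, 0 < m ∧ ∃ C : ℝ, 0 ≤ C ∧ ∀ᶠ ε in epsToZero, ∀ ρ : roumieuTestFunctions ω Ω,
      tsupport (ρ : EuclideanSpace ℝ (Fin d) → ℂ) ⊆ K →
      fourierNorm ω l (ρ : EuclideanSpace ℝ (Fin d) → ℂ) < ⊤ →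
        ‖u ε ρ‖ ≤ C * (fourierNorm ω l (ρ : EuclideanSpace ℝ (Fin d) → ℂ)).toReal *
          Real.exp (-(m * ω (1 / (ε : ℝ)))) := by
  obtain ⟨m, hm, C, hC, h⟩ := exists_uniform_negligible_of_le_one hK hKΩ hl u hu hneg
  refine ⟨m, hm, C, hC, ?_⟩
  filter_upwards [h] with ε hε ρ hρK hρl
  set N := (fourierNorm ω l (ρ : EuclideanSpace ℝ (Fin d) → ℂ)).toReal with hN
  have hN0 : 0 ≤ N := ENNReal.toReal_nonneg
  rcases hN0.eq_or_lt with h0 | h0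
  -- Normalization is impossible when the norm is zero, but then continuity of `u ε` alone makes the
  -- value vanish.
  · obtain ⟨B, -, hB⟩ := hu ε
    have := hB ρ hρK hρl
    rw [← hN, ← h0, mul_zero] at this
    rw [← h0, mul_zero, zero_mul]
    exact this
  · have hsmul : ‖u ε (((N⁻¹ : ℝ) : ℂ) • ρ)‖ ≤ C * Real.exp (-(m * ω (1 / (ε : ℝ)))) := by
      refine hε _ ((tsupport_smul_subset_right (fun _ => ((N⁻¹ : ℝ) : ℂ)) _).trans hρK) ?_
      rw [Submodule.coe_smul, fourierNorm_smul, ← ofReal_norm, Complex.norm_real,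
        Real.norm_of_nonneg (inv_nonneg.2 hN0), ← ENNReal.ofReal_toReal hρl.ne, ← hN,
        ← ENNReal.ofReal_mul (inv_nonneg.2 hN0), inv_mul_cancel₀ h0.ne', ENNReal.ofReal_one]
    rw [map_smul, norm_smul, Complex.norm_real, Real.norm_of_nonneg (inv_nonneg.2 hN0),
      inv_mul_le_iff₀ h0] at hsmul
    linarith

/-! ### Continuity of the pairing -/

/-- The pairing with a function of `ℰ^{ω}(Ω)`, as a linear form on the test functions. -/
noncomputable def pairingLinear {d : ℕ} {ω : WeightFunction}
    {Ω : TopologicalSpace.Opens (EuclideanSpace ℝ (Fin d))} (f : roumieuFunctions ω Ω) :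
    roumieuTestFunctions ω Ω →ₗ[ℂ] ℂ where
  toFun ρ := pairing (f : EuclideanSpace ℝ (Fin d) → ℂ) ρ
  map_add' ρ σ := by
    rw [pairing, pairing, pairing, ← integral_add (integrable_pairing f ρ) (integrable_pairing f σ)]
    refine integral_congr_ae (ae_of_all _ fun x => ?_)
    simp [mul_add]
  map_smul' c ρ := by
    rw [pairing, pairing, RingHom.id_apply, smul_eq_mul, ← integral_const_mul]
    refine integral_congr_ae (ae_of_all _ fun x => ?_)
    simp [mul_left_comm]

/-- Multiplying f by χ does not change the pairing, and χf is integrable. The constant may depend on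
f: Banach–Steinhaus needs only continuity of each functional of the net. -/
theorem exists_norm_pairing_le {d : ℕ} {ω : WeightFunction}
    {Ω : TopologicalSpace.Opens (EuclideanSpace ℝ (Fin d))} (f : roumieuFunctions ω Ω)
    {K : Set (EuclideanSpace ℝ (Fin d))} {χ : EuclideanSpace ℝ (Fin d) → ℂ}
    (hχ : χ ∈ roumieuTestFunctions ω Ω) (hχK : ∀ x ∈ K, χ x = 1) {l : ℝ} (hl : 0 ≤ l) :
    ∃ B : ℝ, 0 ≤ B ∧ ∀ ρ : roumieuTestFunctions ω Ω,
      tsupport (ρ : EuclideanSpace ℝ (Fin d) → ℂ) ⊆ K →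
      fourierNorm ω l (ρ : EuclideanSpace ℝ (Fin d) → ℂ) < ⊤ →
        ‖pairing (f : EuclideanSpace ℝ (Fin d) → ℂ) ρ‖ ≤
          B * (fourierNorm ω l (ρ : EuclideanSpace ℝ (Fin d) → ℂ)).toReal := by
  have hχf := f.2.2 χ hχ
  have hi : Integrable (χ * (f : EuclideanSpace ℝ (Fin d) → ℂ)) :=
    hχf.1.continuous.integrable_of_hasCompactSupport hχf.2.1
  refine ⟨∫ x, ‖(χ * (f : EuclideanSpace ℝ (Fin d) → ℂ)) x‖,
    integral_nonneg fun x => norm_nonneg _, fun ρ hρK hρl => ?_⟩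
  rw [← integral_mul_const]
  refine norm_integral_le_of_norm_le (hi.norm.mul_const _) (ae_of_all _ fun x => ?_)
  have h1 := congrFun (mul_eq_mul_of_eq_one (f := (f : EuclideanSpace ℝ (Fin d) → ℂ)) hρK hχK) x
  simp only [Pi.mul_apply] at h1
  rw [mul_comm, ← h1, norm_mul, mul_comm]
  gcongr
  · exact le_rfl
  · exact norm_le_toReal_fourierNorm hl ρ.2.1 ρ.2.2.1 hρl x

/-! ### Interplay of the two Fourier bounds -/

section Decay

variable {V : Type*} [NormedAddCommGroup V] {ω : WeightFunction} {D : Eps → V → ℂ} {F : V → ℂ}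
  {h l m C : ℝ}

/-- Both bounds are uniform in ξ, so ε may depend on ξ; F is then estimated through F = D - (D - F)
at the ε with ω(1/ε) = pω(|ξ|). -/
theorem exists_norm_limit_le (hh : 0 < h) (hl : 0 ≤ l) (hm : 0 < m) (hC : 0 ≤ C)
    (hD : ∀ᶠ ε : Eps in epsToZero, ∀ ξ,
      ‖D ε ξ - F ξ‖ ≤ C * Real.exp (l * ω ‖ξ‖ - m * ω (1 / (ε : ℝ))))
    (hreg : ∀ k : ℝ, 0 < k → ∃ A : ℝ, 0 ≤ A ∧ ∀ᶠ ε : Eps in epsToZero, ∀ ξ,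
      ‖D ε ξ‖ ≤ A * Real.exp (k * ω (1 / (ε : ℝ)) - h * ω ‖ξ‖)) :
    ∃ B : ℝ, 0 ≤ B ∧ ∀ ξ, ‖F ξ‖ ≤ B * Real.exp (-(h / 2 * ω ‖ξ‖)) := by
  -- This p makes l - mp = -h. The choice of k below makes kp - h = -h/2. Since k depends on m, it
  -- matters that h was fixed before k.
  set p := (l + h) / m with hp
  have hp0 : 0 < p := by positivity
  set k := h / (2 * p) with hk
  have hk0 : 0 < k := by positivity
  obtain ⟨A, hA, hA'⟩ := hreg k hk0
  obtain ⟨s₀, hs₀, hs⟩ := exists_forall_weight_of_eventually ω (hD.and hA')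
  set s := max s₀ (ω 1) with hs'
  have hs0 : 0 < s := hs₀.trans_le (le_max_left _ _)
  have key : ∀ ξ τ, s < τ → ‖F ξ‖ ≤ C * Real.exp (l * ω ‖ξ‖ - m * τ) +
      A * Real.exp (k * τ - h * ω ‖ξ‖) := by
    intro ξ τ hτ
    obtain ⟨ε, hε⟩ := exists_eps_weight_eq ω ((le_max_right _ _).trans_lt hτ)
    have h1 := hs ε (by rw [hε]; exact (le_max_left _ _).trans_lt hτ)
    rw [hε] at h1
    have h2 : F ξ = D ε ξ - (D ε ξ - F ξ) := by ring
    rw [h2]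
    exact (norm_sub_le _ _).trans ((add_comm _ _).trans_le (add_le_add (h1.1 ξ) (h1.2 ξ)))
  -- M bounds F where pω(|ξ|) ≤ s, by taking τ = s + 1; the factor e^{(h/2)(s/p)} compensates the
  -- decay required there.
  set M := C * Real.exp (l * (s / p)) + A * Real.exp (k * (s + 1)) with hM
  refine ⟨(C + A) + M * Real.exp (h / 2 * (s / p)), by positivity, fun ξ => ?_⟩
  have hω := ω.nonneg (norm_nonneg ξ)
  rcases lt_or_ge s (p * ω ‖ξ‖) with hlt | hge
  · refine (key ξ _ hlt).trans ?_
    have e1 : l * ω ‖ξ‖ - m * (p * ω ‖ξ‖) ≤ -(h / 2 * ω ‖ξ‖) := by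
      have : m * (p * ω ‖ξ‖) = (l + h) * ω ‖ξ‖ := by
        rw [hp]
        field_simp
      rw [this]
      nlinarith
    have e2 : k * (p * ω ‖ξ‖) - h * ω ‖ξ‖ = -(h / 2 * ω ‖ξ‖) := by
      rw [hk]
      field_simp
      ring
    rw [e2, add_mul, add_mul]
    have e3 : C * Real.exp (l * ω ‖ξ‖ - m * (p * ω ‖ξ‖)) ≤ C * Real.exp (-(h / 2 * ω ‖ξ‖)) := by
      gcongr
    have e4 : 0 ≤ M * Real.exp (h / 2 * (s / p)) * Real.exp (-(h / 2 * ω ‖ξ‖)) := by positivity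
    linarith
  · have hωs : ω ‖ξ‖ ≤ s / p := by
      rw [le_div_iff₀ hp0]
      linarith
    have h1 : ‖F ξ‖ ≤ M := by
      refine (key ξ (s + 1) (by linarith)).trans ?_
      rw [hM]
      gcongr
      · have : l * ω ‖ξ‖ ≤ l * (s / p) := by gcongr
        have : 0 ≤ m * (s + 1) := by positivity
        linarith
      · have : 0 ≤ h * ω ‖ξ‖ := by positivity
        linarith
    have h2 : 1 ≤ Real.exp (h / 2 * (s / p)) * Real.exp (-(h / 2 * ω ‖ξ‖)) := by
      rw [← Real.exp_add]
      refine Real.one_le_exp ?_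
      have : h / 2 * ω ‖ξ‖ ≤ h / 2 * (s / p) := by gcongr
      linarith
    have hM0 : 0 ≤ M := by positivity
    calc ‖F ξ‖ ≤ M * 1 := by rw [mul_one]; exact h1
      _ ≤ M * (Real.exp (h / 2 * (s / p)) * Real.exp (-(h / 2 * ω ‖ξ‖))) := by gcongr
      _ ≤ _ := by
        rw [← mul_assoc, add_mul (C + A)]
        exact le_add_of_nonneg_left (by positivity)

/-- Write t = ω(|ξ|), τ = ω(1/ε). The difference is bounded by multiples of e^{lt - mτ} and, using
the decay of F, of e^{mτ/2 - ht/2}. Their geometric mean has exponent -(h/2 - l)t/2 - mτ/4, negative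
in both variables because l < h/2. -/
theorem exists_norm_sub_limit_le (hh : 0 < h) (hl : 0 ≤ l) (hlh : l < h / 2) (hm : 0 < m)
    (hC : 0 ≤ C)
    (hD : ∀ᶠ ε : Eps in epsToZero, ∀ ξ,
      ‖D ε ξ - F ξ‖ ≤ C * Real.exp (l * ω ‖ξ‖ - m * ω (1 / (ε : ℝ))))
    (hreg : ∀ k : ℝ, 0 < k → ∃ A : ℝ, 0 ≤ A ∧ ∀ᶠ ε : Eps in epsToZero, ∀ ξ,
      ‖D ε ξ‖ ≤ A * Real.exp (k * ω (1 / (ε : ℝ)) - h * ω ‖ξ‖)) :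
    ∃ c : ℝ, 0 < c ∧ ∃ B : ℝ, 0 ≤ B ∧ (∀ ξ, ‖F ξ‖ ≤ B * Real.exp (-(c * ω ‖ξ‖))) ∧
      ∀ᶠ ε : Eps in epsToZero, ∀ ξ,
        ‖D ε ξ - F ξ‖ ≤ B * (Real.exp (-(c * ω ‖ξ‖)) * Real.exp (-(c * ω (1 / (ε : ℝ))))) := by
  obtain ⟨B, hB, hF⟩ := exists_norm_limit_le hh hl hm hC hD hreg
  obtain ⟨A, hA, hA'⟩ := hreg (m / 2) (by positivity)
  set c := min ((h / 2 - l) / 2) (m / 4) with hc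
  have hc0 : 0 < c := lt_min (by linarith) (by linarith)
  have hc1 : c ≤ (h / 2 - l) / 2 := min_le_left _ _
  have hc2 : c ≤ m / 4 := min_le_right _ _
  refine ⟨c, hc0, B + √(C * (A + B)), by positivity, fun ξ => ?_, ?_⟩
  · refine (hF ξ).trans ?_
    have hω := ω.nonneg (norm_nonneg ξ)
    gcongr
    · exact le_add_of_nonneg_right (Real.sqrt_nonneg _)
    · linarith
  filter_upwards [hD, hA'] with ε h1 h2 ξ
  set t := ω ‖ξ‖ with ht
  set τ := ω (1 / (ε : ℝ)) with hτ
  have ht0 : 0 ≤ t := ω.nonneg (norm_nonneg ξ)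
  have hτ0 : 0 ≤ τ := ω.nonneg ε.inv_nonneg
  have h3 : ‖D ε ξ - F ξ‖ ≤ (A + B) * Real.exp (m / 2 * τ - h / 2 * t) := by
    refine (norm_sub_le _ _).trans ?_
    rw [add_mul]
    refine add_le_add ((h2 ξ).trans ?_) ((hF ξ).trans ?_)
    · gcongr
      linarith
    · gcongr
      have : 0 ≤ m / 2 * τ := by positivity
      linarith
  refine le_trans ?_ (mul_le_mul_of_nonneg_right (le_add_of_nonneg_left hB) (by positivity))
  -- The geometric mean is taken by comparing squares.
  refine (sq_le_sq₀ (norm_nonneg _) (by positivity)).1 ?_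
  rw [mul_pow, Real.sq_sqrt (by positivity), sq, ← Real.exp_add, ← Real.exp_nat_mul]
  refine (mul_le_mul (h1 ξ) h3 (norm_nonneg _) (by positivity)).trans ?_
  rw [mul_mul_mul_comm, ← Real.exp_add]
  gcongr
  push_cast
  nlinarith

end Decay

/-! ### Limits of nets with converging Fourier transforms -/

section Limit

variable {d : ℕ} {ω : WeightFunction} {G : Eps → EuclideanSpace ℝ (Fin d) → ℂ}
  {F : EuclideanSpace ℝ (Fin d) → ℂ} {c B : ℝ} {K : Set (EuclideanSpace ℝ (Fin d))}

theorem tendsto_exp_neg_weight (ω : WeightFunction) (hc : 0 < c) :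
    Tendsto (fun ε : Eps => Real.exp (-(c * ω (1 / (ε : ℝ))))) epsToZero (𝓝 0) :=
  Real.tendsto_exp_neg_atTop_nhds_zero.comp ((tendsto_weight_eps ω).const_mul_atTop hc)

/-- The supremum norm is at most the norm of index 0, an integral of the transform; the factor
e^{-cω(|ξ|)} makes that integral finite and the other factor makes it small. -/
theorem uniformCauchySeqOn_of_fhat (hc : 0 < c) (hB : 0 ≤ B) (hK : IsCompact K)
    (hG : ∀ ε, ContDiff ℝ ((⊤ : ℕ∞) : WithTop ℕ∞) (G ε)) (hGK : ∀ ε, tsupport (G ε) ⊆ K)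
    (hGF : ∀ᶠ ε : Eps in epsToZero, ∀ ξ, ‖fhat (G ε) ξ - F ξ‖ ≤
      B * (Real.exp (-(c * ω ‖ξ‖)) * Real.exp (-(c * ω (1 / (ε : ℝ)))))) :
    UniformCauchySeqOn G epsToZero Set.univ := by
  have hGc : ∀ ε, HasCompactSupport (G ε) := fun ε =>
    hK.of_isClosed_subset (isClosed_tsupport _) (hGK ε)
  have hGi : ∀ ε, Integrable (G ε) := fun ε =>
    (hG ε).continuous.integrable_of_hasCompactSupport (hGc ε)
  set I := (∫⁻ ξ : EuclideanSpace ℝ (Fin d), ENNReal.ofReal (Real.exp (-(c * ω ‖ξ‖)))).toReal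
    with hI
  have hIfin := ω.lintegral_exp_neg_lt_top (d := d) hc
  intro u hu
  obtain ⟨δ, hδ, hδu⟩ := Metric.mem_uniformity_dist.1 hu
  have hsmall : ∀ᶠ ε : Eps in epsToZero, B * I * Real.exp (-(c * ω (1 / (ε : ℝ)))) < δ / 2 := by
    have := (tendsto_exp_neg_weight ω hc).const_mul (B * I)
    rw [mul_zero] at this
    exact this.eventually (gt_mem_nhds (by positivity))
  have hgood := hGF.and hsmall
  filter_upwards [hgood.prod_mk hgood] with ⟨ε, ε'⟩ ⟨⟨h1, h2⟩, h1', h2'⟩ x _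
  dsimp only at h1 h2 h1' h2' ⊢
  refine hδu ?_
  rw [dist_eq_norm]
  set b := Real.exp (-(c * ω (1 / (ε : ℝ)))) with hb
  set b' := Real.exp (-(c * ω (1 / (ε' : ℝ)))) with hb'
  have h3 : ‖G ε x - G ε' x‖ₑ ≤ ENNReal.ofReal (B * I * b + B * I * b') := by
    have hsub : G ε - G ε' = G ε + (-1 : ℂ) • G ε' := by simp [sub_eq_add_neg]
    have h4 := enorm_le_fourierNorm ω le_rfl ((hG ε).sub (hG ε'))
      ((hGc ε).sub (hGc ε')) x
    refine h4.trans ?_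
    calc fourierNorm ω 0 (G ε - G ε')
        ≤ ∫⁻ ξ, ENNReal.ofReal (Real.exp (-(c * ω ‖ξ‖))) * ENNReal.ofReal (B * (b + b')) := by
          refine lintegral_mono fun ξ => ?_
          rw [zero_mul, Real.exp_zero, ENNReal.ofReal_one, mul_one,
            ← ENNReal.ofReal_mul (Real.exp_pos _).le, ← ofReal_norm]
          refine ENNReal.ofReal_le_ofReal ?_
          rw [hsub, fhat_add (hGi ε) ((hGi ε').smul _), fhat_smul]
          have h5 : fhat (G ε) ξ + -1 * fhat (G ε') ξ =
              (fhat (G ε) ξ - F ξ) - (fhat (G ε') ξ - F ξ) := by ring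
          rw [h5]
          refine (norm_sub_le _ _).trans ((add_le_add (h1 ξ) (h1' ξ)).trans_eq ?_)
          ring
      _ = ENNReal.ofReal (I * (B * (b + b'))) := by
          rw [lintegral_mul_const' _ _ ENNReal.ofReal_ne_top,
            ENNReal.ofReal_mul ENNReal.toReal_nonneg, ENNReal.ofReal_toReal hIfin.ne]
      _ = _ := by ring_nf
  rw [← ofReal_norm] at h3
  have hI0 : 0 ≤ I := ENNReal.toReal_nonneg
  rw [ENNReal.ofReal_le_ofReal_iff (by positivity)] at h3
  linarith

/-- Uniform convergence inside K identifies the transform of the limit as F. Half of the rate c goes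
into the norm, the other half makes the integral converge. -/
theorem limit_of_fhat (hc : 0 < c) (hB : 0 ≤ B) (hK : IsCompact K)
    (hG : ∀ ε, ContDiff ℝ ((⊤ : ℕ∞) : WithTop ℕ∞) (G ε)) (hGK : ∀ ε, tsupport (G ε) ⊆ K)
    (hF : ∀ ξ, ‖F ξ‖ ≤ B * Real.exp (-(c * ω ‖ξ‖)))
    (hGF : ∀ᶠ ε : Eps in epsToZero, ∀ ξ, ‖fhat (G ε) ξ - F ξ‖ ≤
      B * (Real.exp (-(c * ω ‖ξ‖)) * Real.exp (-(c * ω (1 / (ε : ℝ))))))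
    {f : EuclideanSpace ℝ (Fin d) → ℂ} (hf : ∀ x, Tendsto (fun ε => G ε x) epsToZero (𝓝 (f x))) :
    ContDiff ℝ ((⊤ : ℕ∞) : WithTop ℕ∞) f ∧ fourierNorm ω (c / 2) f < ⊤ ∧ ∀ ξ, fhat f ξ = F ξ := by
  have hGc : ∀ ε, HasCompactSupport (G ε) := fun ε =>
    hK.of_isClosed_subset (isClosed_tsupport _) (hGK ε)
  have hGi : ∀ ε, Integrable (G ε) := fun ε =>
    (hG ε).continuous.integrable_of_hasCompactSupport (hGc ε)
  have hG0 : ∀ ε, ∀ x ∉ K, G ε x = 0 := fun ε x hx =>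
    image_eq_zero_of_notMem_tsupport fun h => hx (hGK ε h)
  have hunif : TendstoUniformly G f epsToZero := tendstoUniformlyOn_univ.1 <|
    (uniformCauchySeqOn_of_fhat hc hB hK hG hGK hGF).tendstoUniformlyOn_of_tendsto
      fun x _ => hf x
  have hcont : Continuous f :=
    hunif.continuous (Eventually.of_forall fun ε => (hG ε).continuous).frequently
  have hf0 : ∀ x ∉ K, f x = 0 := by
    intro x hx
    refine tendsto_nhds_unique (hf x) ?_
    simp only [hG0 _ x hx]
    exact tendsto_const_nhds
  have hfc : HasCompactSupport f := HasCompactSupport.intro hK hf0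
  have hfi : Integrable f := hcont.integrable_of_hasCompactSupport hfc
  have hfF : ∀ ξ, fhat f ξ = F ξ := by
    intro ξ
    have h1 : Tendsto (fun ε => fhat (G ε) ξ) epsToZero (𝓝 (fhat f ξ)) := by
      refine tendsto_integral_filter_of_dominated_convergence
        (fun x => ‖f x‖ + K.indicator (fun _ => (1 : ℝ)) x)
        (Eventually.of_forall fun ε => (integrable_kernel (hGi ε) ξ).aestronglyMeasurable) ?_
        (hfi.norm.add ((integrable_indicator_iff hK.measurableSet).2
          (integrableOn_const hK.measure_lt_top.ne)))
        (ae_of_all _ fun x => (hf x).const_mul _)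
      filter_upwards [Metric.tendstoUniformly_iff.1 hunif 1 one_pos] with ε hε
      refine ae_of_all _ fun x => ?_
      have e : ‖Complex.exp (-(Complex.I * (inner ℝ x ξ : ℝ))) * G ε x‖ = ‖G ε x‖ := by
        simp [Complex.norm_exp]
      rw [e]
      by_cases hx : x ∈ K
      · rw [Set.indicator_of_mem hx]
        have h2 := hε x
        rw [dist_comm, dist_eq_norm] at h2
        have := norm_sub_norm_le (G ε x) (f x)
        linarith
      · rw [hG0 ε x hx, norm_zero, Set.indicator_of_notMem hx, add_zero]
        exact norm_nonneg _
    refine tendsto_nhds_unique h1 ?_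
    rw [tendsto_iff_norm_sub_tendsto_zero]
    have h2 := (tendsto_exp_neg_weight ω hc).const_mul (B * Real.exp (-(c * ω ‖ξ‖)))
    rw [mul_zero] at h2
    refine squeeze_zero' (Eventually.of_forall fun ε => norm_nonneg _) ?_ h2
    filter_upwards [hGF] with ε hε
    rw [mul_assoc]
    exact hε ξ
  have hfin : fourierNorm ω (c / 2) f < ⊤ := by
    have h1 := ENNReal.mul_lt_top (ENNReal.ofReal_lt_top (r := B))
      (ω.lintegral_exp_neg_lt_top (d := d) (half_pos hc))
    rw [← lintegral_const_mul' _ _ ENNReal.ofReal_ne_top] at h1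
    refine lt_of_le_of_lt (lintegral_mono fun ξ => ?_) h1
    rw [hfF, ← ofReal_norm, ← ENNReal.ofReal_mul (norm_nonneg _), ← ENNReal.ofReal_mul hB]
    refine ENNReal.ofReal_le_ofReal ?_
    refine (mul_le_mul_of_nonneg_right (hF ξ) (Real.exp_pos _).le).trans_eq ?_
    rw [mul_assoc, ← Real.exp_add]
    ring_nf
  exact ⟨contDiff_of_fourierNorm_lt_top (half_pos hc) hcont hfi hfin, hfin, hfF⟩

end Limit

/-! ### Regular nets strictly associated to an ultradistribution -/

section Regular

variable {d : ℕ} {ω : WeightFunction} {Ω : TopologicalSpace.Opens (EuclideanSpace ℝ (Fin d))}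
  {g : Eps → roumieuFunctions ω Ω} {φ : EuclideanSpace ℝ (Fin d) → ℂ}

/-- Without cutoffs the local norm would be an infimum over the empty set, hence infinite for every
ε, against regularity. -/
theorem IsRegularNet.exists_cutoff (hg : IsRegularNet ω Ω g)
    {K : Set (EuclideanSpace ℝ (Fin d))} (hK : IsCompact K) (hKΩ : K ⊆ Ω) :
    ∃ χ ∈ roumieuTestFunctions ω Ω, ∀ x ∈ K, χ x = 1 := by
  obtain ⟨h, -, hh⟩ := hg.2 K hK hKΩ
  exact _root_.exists_cutoff (hh 1 one_pos)

/-- The Fourier transforms of the products of a regular net with a test function decay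
exponentially, at a rate that does not depend on `ε`. -/
theorem IsRegularNet.exists_norm_fhat_mul_le (hg : IsRegularNet ω Ω g)
    (hφ : φ ∈ roumieuTestFunctions ω Ω) :
    ∃ h : ℝ, 0 < h ∧ ∀ k : ℝ, 0 < k → ∃ A : ℝ, 0 ≤ A ∧ ∀ᶠ ε : Eps in epsToZero, ∀ ξ,
      ‖fhat (φ * (g ε : EuclideanSpace ℝ (Fin d) → ℂ)) ξ‖ ≤
        A * Real.exp (k * ω (1 / (ε : ℝ)) - h * ω ‖ξ‖) := by
  obtain ⟨-, hc, hΩ, l, hl, hfin⟩ := id hφ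
  obtain ⟨h₀, hh₀, hreg⟩ := hg.2 _ hc hΩ
  set h := min l h₀ with hh
  have hpos : 0 < h := lt_min hl hh₀
  have hφh : fourierNorm ω h φ < ⊤ := (fourierNorm_mono ω (min_le_left _ _) φ).trans_lt hfin
  obtain ⟨C, hC, hdecay⟩ := exists_norm_fhat_le ω hpos.le hc
  -- The rate loses the factor d+1 of the pointwise decay, but it is chosen before k; only the set
  -- of admissible ε depends on k.
  refine ⟨h / (d + 1), by positivity, fun k hk =>
    ⟨C * (fourierNorm ω h φ + 1).toReal, by positivity, ?_⟩⟩
  filter_upwards [(hreg k hk).eventually_le] with ε hε ξ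
  have hmem := (g ε).2.2 φ hφ
  have h1 : fourierNorm ω h (φ * (g ε : EuclideanSpace ℝ (Fin d) → ℂ)) ≤
      (fourierNorm ω h φ + 1) * ENNReal.ofReal (Real.exp (k * ω (1 / (ε : ℝ)))) := by
    refine (fourierNorm_mul_le_localNorm hpos.le hφ subset_rfl hφh.ne (g ε).2).trans ?_
    gcongr
    exact (localNorm_mono ω Ω _ (min_le_right _ _) _).trans hε
  have htop : fourierNorm ω h φ + 1 < ⊤ := ENNReal.add_lt_top.2 ⟨hφh, ENNReal.one_lt_top⟩
  have htop' := ENNReal.mul_lt_top htop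
    (ENNReal.ofReal_lt_top (r := Real.exp (k * ω (1 / (ε : ℝ)))))
  have h2 := ENNReal.toReal_mono htop'.ne h1
  rw [ENNReal.toReal_mul, ENNReal.toReal_ofReal (Real.exp_pos _).le] at h2
  refine (hdecay _ hmem.1 (tsupport_mul_subset_left (f := φ)) (h1.trans_lt htop') ξ).trans ?_
  rw [sub_eq_add_neg, Real.exp_add, ← mul_assoc]
  refine mul_le_mul_of_nonneg_right ?_ (Real.exp_pos _).le
  rw [mul_assoc]
  gcongr

theorem exists_uniform_association (hg : IsRegularNet ω Ω g) (T : RoumieuUltradistribution ω Ω)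
    (hT : ∀ ρ : roumieuTestFunctions ω Ω, IsZeroConstant ω
      (fun ε => pairing (g ε : EuclideanSpace ℝ (Fin d) → ℂ) ρ - T.toLinearMap ρ))
    {K : Set (EuclideanSpace ℝ (Fin d))} (hK : IsCompact K) (hKΩ : K ⊆ Ω) {l : ℝ} (hl : 0 < l) :
    ∃ m : ℝ, 0 < m ∧ ∃ C : ℝ, 0 ≤ C ∧ ∀ᶠ ε in epsToZero, ∀ ρ : roumieuTestFunctions ω Ω,
      tsupport (ρ : EuclideanSpace ℝ (Fin d) → ℂ) ⊆ K →
      fourierNorm ω l (ρ : EuclideanSpace ℝ (Fin d) → ℂ) < ⊤ →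
        ‖pairing (g ε : EuclideanSpace ℝ (Fin d) → ℂ) ρ - T.toLinearMap ρ‖ ≤
          C * (fourierNorm ω l (ρ : EuclideanSpace ℝ (Fin d) → ℂ)).toReal *
            Real.exp (-(m * ω (1 / (ε : ℝ)))) := by
  obtain ⟨χ, hχ, hχK⟩ := hg.exists_cutoff hK hKΩ
  refine exists_uniform_negligible hK hKΩ hl (fun ε => pairingLinear (g ε) - T.toLinearMap)
    (fun ε => ?_) (fun ρ => isZeroConstant_iff.1 (hT ρ))
  obtain ⟨B, hB, hB'⟩ := exists_norm_pairing_le (g ε) hχ hχK hl.le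
  obtain ⟨C, hC⟩ := T.bound' K hK hKΩ l hl
  refine ⟨B + |C|, by positivity, fun ρ hρK hρl => ?_⟩
  rw [add_mul]
  refine (norm_sub_le _ _).trans (add_le_add (hB' ρ hρK hρl) ((hC ρ hρK hρl).trans ?_))
  gcongr
  exact le_abs_self C

theorem exists_fhat_sub_le (hg : IsRegularNet ω Ω g) (T : RoumieuUltradistribution ω Ω)
    (hT : ∀ ρ : roumieuTestFunctions ω Ω, IsZeroConstant ω
      (fun ε => pairing (g ε : EuclideanSpace ℝ (Fin d) → ℂ) ρ - T.toLinearMap ρ))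
    (hφ : φ ∈ roumieuTestFunctions ω Ω) :
    ∃ c : ℝ, 0 < c ∧ ∃ B : ℝ, 0 ≤ B ∧
      (∀ ξ, ‖T.toLinearMap ⟨modulate ξ φ, modulate_mem ξ hφ⟩‖ ≤ B * Real.exp (-(c * ω ‖ξ‖))) ∧
      ∀ᶠ ε : Eps in epsToZero, ∀ ξ,
        ‖fhat (φ * (g ε : EuclideanSpace ℝ (Fin d) → ℂ)) ξ -
          T.toLinearMap ⟨modulate ξ φ, modulate_mem ξ hφ⟩‖ ≤
          B * (Real.exp (-(c * ω ‖ξ‖)) * Real.exp (-(c * ω (1 / (ε : ℝ))))) := by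
  obtain ⟨-, hc, hΩ, l₀, hl₀, hfin⟩ := id hφ
  obtain ⟨h, hh, hreg⟩ := hg.exists_norm_fhat_mul_le hφ
  -- The bound l < h/2 needed for the geometric mean is arranged by h/4. The rate m of association
  -- is obtained after l, so it may depend on it.
  set l := min l₀ (h / 4) with hl
  have hlpos : 0 < l := lt_min hl₀ (by positivity)
  have hφl : fourierNorm ω l φ < ⊤ := (fourierNorm_mono ω (min_le_left _ _) φ).trans_lt hfin
  obtain ⟨m, hm, C, hC, hass⟩ := exists_uniform_association hg T hT hc hΩ hlpos
  refine exists_norm_sub_limit_le (l := l) (m := m) (C := C * (fourierNorm ω l φ).toReal)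
    hh hlpos.le ((min_le_right _ _).trans_lt (by linarith)) hm (by positivity) ?_ hreg
  filter_upwards [hass] with ε hε ξ
  have h1 := fourierNorm_modulate_le ω hlpos.le ξ φ
  have htop := ENNReal.mul_lt_top (ENNReal.ofReal_lt_top (r := Real.exp (l * ω ‖ξ‖))) hφl
  have h2 := ENNReal.toReal_mono htop.ne h1
  rw [ENNReal.toReal_mul, ENNReal.toReal_ofReal (Real.exp_pos _).le] at h2
  have h3 := hε ⟨modulate ξ φ, modulate_mem ξ hφ⟩ (tsupport_modulate_subset ξ φ)
    (h1.trans_lt htop)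
  rw [pairing_modulate] at h3
  refine h3.trans ?_
  rw [sub_eq_add_neg, Real.exp_add, ← mul_assoc]
  refine mul_le_mul_of_nonneg_right ?_ (Real.exp_pos _).le
  rw [mul_assoc, mul_comm (fourierNorm ω l φ).toReal]
  gcongr

theorem IsRegularNet.isUltradifferentiable (hg : IsRegularNet ω Ω g)
    (T : RoumieuUltradistribution ω Ω)
    (hT : ∀ ρ : roumieuTestFunctions ω Ω, IsZeroConstant ω
      (fun ε => pairing (g ε : EuclideanSpace ℝ (Fin d) → ℂ) ρ - T.toLinearMap ρ)) :
    T.IsUltradifferentiable := by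
  have hlim : ∀ x ∈ Ω, ∃ y, Tendsto (fun ε => (g ε : EuclideanSpace ℝ (Fin d) → ℂ) x)
      epsToZero (𝓝 y) := by
    intro x hx
    obtain ⟨χ, hχ, hχx⟩ := hg.exists_cutoff (isCompact_singleton (x := x))
      (Set.singleton_subset_iff.2 hx)
    obtain ⟨c, hc, B, hB, -, hGF⟩ := exists_fhat_sub_le hg T hT hχ
    have hcauchy := uniformCauchySeqOn_of_fhat hc hB hχ.2.1 (fun ε => ((g ε).2.2 χ hχ).1)
      (fun ε => tsupport_mul_subset_left) hGF
    obtain ⟨y, hy⟩ := cauchy_map_iff_exists_tendsto.1 (hcauchy.cauchy_map (Set.mem_univ x))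
    refine ⟨y, hy.congr fun ε => ?_⟩
    simp [hχx x rfl]
  -- Outside Ω the values of f are arbitrary; every product φf vanishes there.
  choose! f hf using hlim
  have hmul : ∀ φ ∈ roumieuTestFunctions ω Ω, ∀ x,
      Tendsto (fun ε => (φ * (g ε : EuclideanSpace ℝ (Fin d) → ℂ)) x) epsToZero
        (𝓝 ((φ * f) x)) := by
    intro φ hφ x
    simp only [Pi.mul_apply]
    by_cases hx : x ∈ tsupport φ
    · exact (hf x (hφ.2.2.1 hx)).const_mul _
    · simp [image_eq_zero_of_notMem_tsupport hx]
  have hmain : ∀ φ (hφ : φ ∈ roumieuTestFunctions ω Ω), φ * f ∈ roumieuTestFunctions ω Ω ∧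
      ∀ ξ, fhat (φ * f) ξ = T.toLinearMap ⟨modulate ξ φ, modulate_mem ξ hφ⟩ := by
    intro φ hφ
    obtain ⟨c, hc, B, hB, hF, hGF⟩ := exists_fhat_sub_le hg T hT hφ
    obtain ⟨h1, h2, h3⟩ := limit_of_fhat hc hB hφ.2.1 (fun ε => ((g ε).2.2 φ hφ).1)
      (fun ε => tsupport_mul_subset_left) hF hGF (hmul φ hφ)
    exact ⟨⟨h1, hφ.2.1.mul_right, tsupport_mul_subset_left.trans hφ.2.2.1, c / 2, half_pos hc, h2⟩,
      h3⟩
  refine ⟨f, ⟨fun x hx => ContDiffAt.contDiffWithinAt ?_, fun φ hφ => (hmain φ hφ).1⟩, fun ρ => ?_⟩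
  · obtain ⟨r, hr, hrΩ⟩ := Metric.nhds_basis_closedBall.mem_iff.1 (Ω.isOpen.mem_nhds hx)
    obtain ⟨χ, hχ, hχ1⟩ := hg.exists_cutoff (isCompact_closedBall x r) hrΩ
    refine (hmain χ hχ).1.1.contDiffAt.congr_of_eventuallyEq ?_
    filter_upwards [Metric.closedBall_mem_nhds x hr] with y hy
    simp [hχ1 y hy]
  -- At frequency 0 the modulation is trivial and the Fourier transform is the integral.
  · have h1 := (hmain ρ ρ.2).2 0
    have h2 : modulate 0 (ρ : EuclideanSpace ℝ (Fin d) → ℂ) = ρ := by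
      ext x
      simp [modulate]
    have h3 : (⟨modulate 0 ρ, modulate_mem 0 ρ.2⟩ : roumieuTestFunctions ω Ω) = ρ :=
      Subtype.ext h2
    rw [h3, ← pairing_modulate, h2] at h1
    exact h1.symm

end Regular

theorem mainTheorem2 {d : ℕ} (ω : WeightFunction)
    (Ω : TopologicalSpace.Opens (EuclideanSpace ℝ (Fin d)))
    (T : RoumieuUltradistribution ω Ω) (g : RoumieuGeneralizedFunction ω Ω)
    (hg : g.IsRegular) (hTg : StrictlyAssociated T g) :
    T.IsUltradifferentiable := by
  obtain ⟨f, rfl, hf⟩ := hg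
  -- Strict association does not depend on the representative, so on the class of f it unfolds to
  -- the condition for the regular net f itself.
  exact hf.isUltradifferentiable T hTg
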